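/- **Setting.** Bitstrings are elements of $\mathbf F_2^k$; $\oplus$ is addition, $|\mathbf x|$ is the number of ones, and $\mathbf x\cdot\mathbf y$ is the inner product over $\mathbf F_2$. Let $|i\rangle_0$ ($i=0,1$) be the computational basis of a qubit, $|0\rangle_1=\frac{|0\rangle_0+|1\rangle_0}{\sqrt2}$, $|1\rangle_1=\frac{|0\rangle_0-|1\rangle_0}{\sqrt2}$, and $|\mathbf i\rangle_{\mathbf b}=\bigotimes_{k=1}^N|i_k\rangle_{b_k}$ for $\mathbf i,\mathbf b\in\mathbf F_2^N$. *Protocol.* Let $r\ge 0$ and $r+1\le n\le N$, let $\mathbf b\in\mathbf F_2^N$ be a basis string and let $\mathbf s\in\mathbf F_2^N$ with $|\mathbf s|=n$. For a string $\mathbf x\in\mathbf F_2^N$ let $\mathbf x_{\mathrm I}\in\mathbf F_2^n$ be its substring at the INFO positions ($s_k=1$) and $\mathbf x_{\mathrm T}\in\mathbf F_2^{N-n}$ its substring at the TEST positions ($s_k=0$). Alice sends $|\mathbf i\rangle_{\mathbf b}$ with $\mathbf i$ uniformly random, Eve attacks, and Bob measures in the basis $\mathbf b$ and obtains $\mathbf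 j$. Independently, an $r\times n$ matrix $P_{\mathrm C}$ and a $1\times n$ matrix $P_{\mathrm K}=(v_{r+1})$ over $\mathbf F_2$ are chosen uniformly among the pairs whose $r+1$ rows are linearly independent. The syndrome is $\boldsymbol\xi=\mathbf i_{\mathrm I}P_{\mathrm C}^{\mathsf T}$ and the $1$-bit key is $k=\mathbf i_{\mathrm I}\cdot v_{r+1}$. In the hypothetical "inverted-INFO-basis" protocol the basis string $\mathbf b\oplus\mathbf s$ is used in place of $\mathbf b$ (by Alice and by Bob), with the same attack. *Attacks.* A joint attack consists of a finite-dimensional probe space $\mathrm E$, a unit vector $|0\rangle_{\mathrm E}$ and a unitary $U$ on the probe and the $N$ qubits, applied to $|0\rangle_{\mathrm E}|\mathbf i\rangle_{\mathbf b}$. Its symmetrization has the additional probe $\mathrm M$ with orthonormal basis $\{|\mathbf m\rangle_{\mathrm M}\}_{\mathbf m\in\mathbf F_2^N}$ and initial state $2^{-N/2}\sum_{\mathbf m}|\mathbf m\rangle_{\mathrm M}$, and the unitary $U^{\mathrm{sym}}=(\mathbf I_{\mathrm E}\otimes S^\dagger)(U\otimes\mathbf I_{\mathrm M})(\mathbf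 I_{\mathrm E}\otimes S)$, where $S|\mathbf i\rangle_{\mathbf b}|\mathbf m\rangle_{\mathrm M}=(-1)^{(\mathbf i\oplus\mathbf b)\cdot\mathbf m}|\mathbf i\oplus\mathbf m\rangle_{\mathbf b}|\mathbf m\rangle_{\mathrm M}$ (this is the same operator for every $\mathbf b$). A symmetrized attack is the symmetrization of some joint attack. $\Pr^{\mathrm{sym}}$ and $\Pr^{\mathrm{sym}}_{\text{inverted-INFO-basis}}$ denote probabilities in the two protocols under the symmetrized attack. *Eve's states.* Fix $\mathbf i_{\mathrm T},\mathbf j_{\mathrm T}\in\mathbf F_2^{N-n}$ with $\Pr^{\mathrm{sym}}(\mathbf i_{\mathrm T},\mathbf j_{\mathrm T}\mid\mathbf b,\mathbf s)>0$ and $\boldsymbol\xi\in\mathbf F_2^r$. Let $\rho^{\mathbf i_{\mathrm I}}$ be the normalized state of Eve's probes after the symmetrized attack (Bob traced out) given that Alice sent $\mathbf i_{\mathrm I},\mathbf i_{\mathrm T}$ in the basis $\mathbf b$ and Bob measured $\mathbf j_{\mathrm T}$ on the TEST qubits, and for $k\in\{0,1\}$ let $$\widehat\rho^{\,\mathrm{sym}}_k=\frac1{2^{n-r-1}}\sum_{P_{\mathrm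 C},P_{\mathrm K}}\ \sum_{\substack{\mathbf i_{\mathrm I}\in\mathbf F_2^n:\ \mathbf i_{\mathrm I}P_{\mathrm C}^{\mathsf T}=\boldsymbol\xi,\\ \mathbf i_{\mathrm I}\cdot v_{r+1}=k}}\Pr(P_{\mathrm C},P_{\mathrm K})\;\rho^{\mathbf i_{\mathrm I}}\otimes|P_{\mathrm C},P_{\mathrm K}\rangle\langle P_{\mathrm C},P_{\mathrm K}| ,$$ where the vectors $|P_{\mathrm C},P_{\mathrm K}\rangle$ form an orthonormal basis of a classical register. **Theorem.** For every symmetrized attack, all $\mathbf b,\mathbf s,\mathbf i_{\mathrm T},\mathbf j_{\mathrm T},\boldsymbol\xi$ as above, and every integer $0\le t\le\frac n2$, $$\frac12\operatorname{tr}\left|\widehat\rho^{\,\mathrm{sym}}_0-\widehat\rho^{\,\mathrm{sym}}_1\right|\le 2\sqrt{\Pr\nolimits^{\mathrm{sym}}_{\text{inverted-INFO-basis}}\left[|\mathbf C_{\mathrm I}|\ge t\ \middle|\ \mathbf i_{\mathrm T},\mathbf j_{\mathrm T},\mathbf b,\mathbf s\right]+2^{\,n[H_2(t/n)-(n-r-1)/n]}},$$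 where $\mathbf C_{\mathrm I}=\mathbf i_{\mathrm I}\oplus\mathbf j_{\mathrm I}$ and $H_2(x)=-x\log_2x-(1-x)\log_2(1-x)$ (with $0\log_2 0=0$). -/

import Mathlib

noncomputable section

namespace BB84

open scoped Matrix Kronecker ComplexOrder MatrixOrder

/-- Bitstrings of length `k`, the row vectors of `F₂ᵏ`; addition is XOR, and the number of `1`-bits
is `hammingNorm`. -/
abbrev Bits (k : ℕ) : Type := Fin k → ZMod 2

/-- The sign `(-1) ^ x` of a bit `x`. -/
def sgn (x : ZMod 2) : ℂ := (-1) ^ x.val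

/-- The qubit state `|i⟩_b` in coordinates with respect to the `z` basis: the `z` basis for `b = 0`,
and the `x` basis `(|0⟩ + |1⟩)/√2`, `(|0⟩ - |1⟩)/√2` for `b = 1`. -/
def qubitKet (b i : ZMod 2) : ZMod 2 → ℂ := fun x =>
  if b = 0 then (if x = i then 1 else 0) else sgn (i * x) / (Real.sqrt 2 : ℂ)

/-- The `N`-qubit product state `|i⟩_b = ⊗ₖ |iₖ⟩_{bₖ}`, in coordinates with respect to the
computational basis of the `N` qubits. -/
def ket {N : ℕ} (b i : Bits N) : Bits N → ℂ := fun x => ∏ k, qubitKet (b k) (i k) (x k)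

/-- A joint attack on `N` qubits with a probe whose Hilbert space has an orthonormal basis indexed
by `E`: a normalized initial probe state, and a unitary operator on the probe and the qubits. -/
structure JointAttack (N : ℕ) (E : Type*) [Fintype E] [DecidableEq E] where
  /-- the initial state `|0⟩_E` of the probe -/
  probe : E → ℂ
  probe_norm : ∑ e, ‖probe e‖ ^ 2 = 1
  /-- the unitary operator applied to the probe and the `N` qubits -/
  U : Matrix (E × Bits N) (E × Bits N) ℂ
  U_unitary : U ∈ Matrix.unitaryGroup (E × Bits N) ℂ

section Symmetrization

/-- The operator `S |i⟩ |m⟩_M = (-1)^(i·m) |i ⊕ m⟩ |m⟩_M`, given on the computational basis of the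
qubits (the basis string `b = 0`). An index is a pair `(m, i)`. -/
def symS (N : ℕ) : Matrix (Bits N × Bits N) (Bits N × Bits N) ℂ := fun y x =>
  if y.1 = x.1 ∧ y.2 = x.2 + x.1 then sgn (x.2 ⬝ᵥ x.1) else 0

lemma sgn_add (x y : ZMod 2) : sgn (x + y) = sgn x * sgn y := by
  unfold sgn
  revert x y
  have h : ∀ x y : ZMod 2, ((-1 : ℤ)) ^ (x + y).val = (-1) ^ x.val * (-1) ^ y.val := by decide
  intro x y
  exact_mod_cast congrArg (Int.cast : ℤ → ℂ) (h x y)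

lemma sgn_sum {ι : Type*} (s : Finset ι) (f : ι → ZMod 2) :
    sgn (∑ k ∈ s, f k) = ∏ k ∈ s, sgn (f k) := by
  classical
  induction s using Finset.induction_on with
  | empty => simp [sgn]
  | insert a s ha ih => rw [Finset.sum_insert ha, Finset.prod_insert ha, sgn_add, ih]

lemma sgn_mul_self (x : ZMod 2) : sgn x * sgn x = 1 := by
  rw [← sgn_add, CharTwo.add_self_eq_zero]; simp [sgn]

lemma star_sgn (x : ZMod 2) : star (sgn x) = sgn x := by
  simp [sgn]

lemma symS_unitary (N : ℕ) : symS N ∈ Matrix.unitaryGroup (Bits N × Bits N) ℂ := by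
  rw [Matrix.mem_unitaryGroup_iff']
  ext ⟨m, i⟩ ⟨m', i'⟩
  rw [Matrix.mul_apply, Finset.sum_eq_single (m, i + m)]
  · by_cases h : m = m'
    · subst h
      by_cases h' : i = i'
      · subst h'
        simp [symS, Matrix.star_apply, star_sgn, sgn_mul_self]
      · simp [symS, h']
    · simp [symS, h]
  · rintro ⟨a, c⟩ - hne
    have : ¬ (a = m ∧ c = i + m) := fun h => hne (by rw [h.1, h.2])
    simp [symS, Matrix.star_apply, this]
  · simp

/-- The defining formula of `S` holds for every basis string `b`:
`S |i⟩_b |m⟩_M = (-1)^((i ⊕ b)·m) |i ⊕ m⟩_b |m⟩_M`. -/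
lemma symS_mulVec {N : ℕ} (b i m : Bits N) :
    symS N *ᵥ (fun x => (if x.1 = m then 1 else 0) * ket b i x.2) =
      fun x => sgn ((i + b) ⬝ᵥ m) * ((if x.1 = m then 1 else 0) * ket b (i + m) x.2) := by
  have hval : ∀ x : ZMod 2, x = 0 ∨ x = 1 := by decide
  have h11 : (1 : ZMod 2) + 1 = 0 := by decide
  have hv1 : (1 : ZMod 2).val = 1 := by decide
  have key : ∀ b i m x : ZMod 2,
      sgn ((x + m) * m) * qubitKet b i (x + m) = sgn ((i + b) * m) * qubitKet b (i + m) x := by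
    intro b i m x
    rcases hval b with rfl | rfl <;> rcases hval i with rfl | rfl <;>
      rcases hval m with rfl | rfl <;> rcases hval x with rfl | rfl <;>
      simp [qubitKet, sgn, hv1, h11, neg_div]
  have haa : ∀ x m : Bits N, x + m + m = x := fun x m => by
    funext k
    simp only [Pi.add_apply, add_assoc, CharTwo.add_self_eq_zero, add_zero]
  ext ⟨m', x⟩
  rw [Matrix.mulVec, dotProduct, Finset.sum_eq_single (m, x + m)]
  · by_cases h : m' = m
    · subst h
      simp only [symS, haa, and_self, if_true, one_mul, dotProduct, sgn_sum, ket]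
      rw [← Finset.prod_mul_distrib, ← Finset.prod_mul_distrib]
      exact Finset.prod_congr rfl fun k _ => key _ _ _ _
    · simp [symS, h]
  · rintro ⟨a, c⟩ - hne
    by_cases ha : a = m
    · subst ha
      have : ¬ (x = c + a) := by
        rintro rfl
        exact hne (by rw [haa])
      simp [symS, this]
    · simp [ha]
  · simp

variable {N : ℕ} {E : Type*} [Fintype E] [DecidableEq E]

lemma reindex_unitary {α β : Type*} [Fintype α] [DecidableEq α] [Fintype β] [DecidableEq β]
    (e : α ≃ β) {A : Matrix α α ℂ} (hA : A ∈ Matrix.unitaryGroup α ℂ) :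
    Matrix.reindex e e A ∈ Matrix.unitaryGroup β ℂ := by
  rw [Matrix.mem_unitaryGroup_iff, Matrix.star_eq_conjTranspose] at *
  rw [Matrix.conjTranspose_reindex, Matrix.reindex_apply, Matrix.reindex_apply,
    Matrix.submatrix_mul_equiv, hA, Matrix.submatrix_one_equiv]

/-- `I_E ⊗ S`, on the probes `E`, `M` and the qubits. -/
def liftS (N : ℕ) (E : Type*) [Fintype E] [DecidableEq E] :
    Matrix ((E × Bits N) × Bits N) ((E × Bits N) × Bits N) ℂ :=
  let e : E × (Bits N × Bits N) ≃ (E × Bits N) × Bits N := (Equiv.prodAssoc _ _ _).symm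
  Matrix.reindex e e ((1 : Matrix E E ℂ) ⊗ₖ symS N)

/-- `U ⊗ I_M`, on the probes `E`, `M` and the qubits. -/
def liftU (U : Matrix (E × Bits N) (E × Bits N) ℂ) :
    Matrix ((E × Bits N) × Bits N) ((E × Bits N) × Bits N) ℂ :=
  let e : (E × Bits N) × Bits N ≃ (E × Bits N) × Bits N :=
    { toFun := fun x => ((x.1.1, x.2), x.1.2)
      invFun := fun x => ((x.1.1, x.2), x.1.2)
      left_inv := fun _ => rfl
      right_inv := fun _ => rfl }
  Matrix.reindex e e (U ⊗ₖ (1 : Matrix (Bits N) (Bits N) ℂ))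

/-- The symmetrized attack: a second probe `M` in the initial state `2^(-N/2) ∑ₘ |m⟩_M` is added,
and the attack operator becomes `(I_E ⊗ S†) (U ⊗ I_M) (I_E ⊗ S)`. -/
def JointAttack.symmetrize (A : JointAttack N E) : JointAttack N (E × Bits N) where
  probe := fun x => A.probe x.1 * (1 / (Real.sqrt (2 ^ N) : ℂ))
  probe_norm := by
    have h : ∀ x : E × Bits N,
        ‖A.probe x.1 * (1 / (Real.sqrt (2 ^ N) : ℂ))‖ ^ 2 = ‖A.probe x.1‖ ^ 2 * (1 / 2 ^ N) := by
      intro x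
      rw [norm_mul, mul_pow, norm_div, norm_one, Complex.norm_real, Real.norm_eq_abs,
        abs_of_nonneg (Real.sqrt_nonneg _), div_pow, one_pow, Real.sq_sqrt (by positivity)]
    simp_rw [h]
    rw [Fintype.sum_prod_type]
    simp only [Finset.sum_const, nsmul_eq_mul, ← Finset.mul_sum, ← Finset.sum_mul, A.probe_norm]
    simp
  U := (liftS N E)ᴴ * liftU A.U * liftS N E
  U_unitary := by
    have hS : liftS N E ∈ Matrix.unitaryGroup ((E × Bits N) × Bits N) ℂ :=
      reindex_unitary _ (Matrix.kronecker_mem_unitary (one_mem _) (symS_unitary N))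
    have hU : liftU A.U ∈ Matrix.unitaryGroup ((E × Bits N) × Bits N) ℂ :=
      reindex_unitary _ (Matrix.kronecker_mem_unitary A.U_unitary (one_mem _))
    exact mul_mem (mul_mem (Unitary.star_mem hS) hU) hS

end Symmetrization

section InfoTest

/-- The increasing enumeration of the INFO positions, those `k` with `sₖ = 1`. -/
def infoPos {N n : ℕ} (s : Bits N) (hs : hammingNorm s = n) : Fin n ≃ {k : Fin N // s k ≠ 0} :=
  (monoEquivOfFin {k : Fin N // s k ≠ 0} (by
    rw [Fintype.card_subtype]; exact hs)).toEquiv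

/-- The increasing enumeration of the TEST positions, those `k` with `sₖ = 0`. -/
def testPos {N n : ℕ} (s : Bits N) (hs : hammingNorm s = n) :
    Fin (N - n) ≃ {k : Fin N // ¬ s k ≠ 0} :=
  (monoEquivOfFin {k : Fin N // ¬ s k ≠ 0} (by
    have h : Fintype.card {k : Fin N // s k ≠ 0} = n := by
      rw [Fintype.card_subtype]; exact hs
    rw [Fintype.card_subtype_compl, h, Fintype.card_fin])).toEquiv

/-- The `N`-bit string with INFO bits `xI` and TEST bits `xT`. -/
def join {N n : ℕ} (s : Bits N) (hs : hammingNorm s = n) (xI : Bits n) (xT : Bits (N - n)) :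
    Bits N := fun k =>
  if h : s k ≠ 0 then xI ((infoPos s hs).symm ⟨k, h⟩) else xT ((testPos s hs).symm ⟨k, h⟩)

end InfoTest

section Probabilities

variable {N n : ℕ} {E : Type*} [Fintype E] [DecidableEq E]

/-- Eve's unnormalized state `|E'_{i,j}⟩_b`, defined by
`U |0⟩_E |i⟩_b = ∑ⱼ |E'_{i,j}⟩_b |j⟩_b`. -/
def JointAttack.eveVec (A : JointAttack N E) (b i j : Bits N) : E → ℂ := fun e =>
  ∑ x, star (ket b j x) * (A.U *ᵥ fun y => A.probe y.1 * ket b i y.2) (e, x)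

/-- `Pr(j | i, b, s) = ⟨E'_{i,j}|E'_{i,j}⟩_b`: Alice sends `|i⟩_b`, Eve attacks, and Bob measures `j`
in the basis `b`. -/
def JointAttack.bornProb (A : JointAttack N E) (b i j : Bits N) : ℝ :=
  ∑ e, ‖A.eveVec b i j e‖ ^ 2

/-- `Pr(i, j | b, s)`, where `b` is the basis string that is used; `i` is uniformly random. -/
def JointAttack.jointProb (A : JointAttack N E) (b i j : Bits N) : ℝ :=
  1 / 2 ^ N * A.bornProb b i j

/-- `Pr(i_T, j_T | b, s)`, where `b` is the basis string that is used. -/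
def JointAttack.testProb (A : JointAttack N E) (b s : Bits N) (hs : hammingNorm s = n)
    (iT jT : Bits (N - n)) : ℝ :=
  ∑ iI : Bits n, ∑ jI : Bits n, A.jointProb b (join s hs iI iT) (join s hs jI jT)

open Classical in
/-- `Pr[C_I ∈ X | i_T, j_T, b, s]`, where `C_I = i_I ⊕ j_I` and `b` is the basis string that is
used. -/
def JointAttack.infoErrorProb (A : JointAttack N E) (b s : Bits N) (hs : hammingNorm s = n)
    (iT jT : Bits (N - n)) (X : Set (Bits n)) : ℝ :=
  (∑ iI : Bits n, ∑ jI : Bits n,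
    if iI + jI ∈ X then A.jointProb b (join s hs iI iT) (join s hs jI jT) else 0) /
    A.testProb b s hs iT jT

/-- `Pr_inverted-INFO-basis[C_I ∈ X | i_T, j_T, b, s]`: Alice chooses `b` and `s`, but Alice and Bob
use the basis string `b ⊕ s`, and Eve performs the same attack. -/
def JointAttack.invertedInfoErrorProb (A : JointAttack N E) (b s : Bits N)
    (hs : hammingNorm s = n) (iT jT : Bits (N - n)) (X : Set (Bits n)) : ℝ :=
  A.infoErrorProb (b + s) s hs iT jT X

/-- `Pr(j_T | i_I, i_T, b, s)`. -/
def JointAttack.testOutcomeProb (A : JointAttack N E) (b s : Bits N) (hs : hammingNorm s = n)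
    (iI : Bits n) (iT jT : Bits (N - n)) : ℝ :=
  ∑ jI : Bits n, A.bornProb b (join s hs iI iT) (join s hs jI jT)

/-- Eve's state `|E_{i_I,j_I}⟩_{b,s}`, normalized by the probability of the TEST outcome `j_T`. -/
def JointAttack.eveCondVec (A : JointAttack N E) (b s : Bits N) (hs : hammingNorm s = n)
    (iT jT : Bits (N - n)) (iI jI : Bits n) : E → ℂ :=
  (1 / (Real.sqrt (A.testOutcomeProb b s hs iI iT jT) : ℂ)) •
    A.eveVec b (join s hs iI iT) (join s hs jI jT)

/-- Eve's density matrix `ρ^{i_I} = ∑_{j_I} |E_{i_I,j_I}⟩⟨E_{i_I,j_I}|` after the attack, given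
`i_I, i_T, j_T, b, s`. -/
def JointAttack.eveState (A : JointAttack N E) (b s : Bits N) (hs : hammingNorm s = n)
    (iT jT : Bits (N - n)) (iI : Bits n) : Matrix E E ℂ :=
  ∑ jI : Bits n, Matrix.vecMulVec (A.eveCondVec b s hs iT jT iI jI)
    (star (A.eveCondVec b s hs iT jT iI jI))

end Probabilities

section Key

/-- Pairs `(P_C, P_K)` of an `r × n` and an `m × n` matrix over `F₂`. -/
abbrev MatPair (n r m : ℕ) : Type :=
  Matrix (Fin r) (Fin n) (ZMod 2) × Matrix (Fin m) (Fin n) (ZMod 2)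

/-- All `r + m` rows of `P_C` and `P_K` put together are linearly independent. -/
def MatPair.Valid {n r m : ℕ} (P : MatPair n r m) : Prop :=
  LinearIndependent (ZMod 2) (Matrix.fromRows P.1 P.2).row

open Classical in
/-- `Pr(P_C, P_K)`: the uniform distribution on the valid pairs. -/
def MatPair.prob {n r m : ℕ} (P : MatPair n r m) : ℝ :=
  if P.Valid then 1 / (Finset.univ.filter fun Q : MatPair n r m => Q.Valid).card else 0

open Classical in
/-- Eve's state for the final key `k`, given the syndrome `ξ` and `i_T, j_T, b, s`: the average over
`P_C, P_K`, which are kept in a classical register, and over the INFO bits `i_I` compatible with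
`ξ` and `k`,
`2^{-(n-r-m)} ∑ Pr(P_C, P_K) ρ^{i_I} ⊗ |P_C, P_K⟩⟨P_C, P_K|`. -/
def JointAttack.keyState {N n r m : ℕ} {E : Type*} [Fintype E] [DecidableEq E]
    (A : JointAttack N E) (b s : Bits N) (hs : hammingNorm s = n) (iT jT : Bits (N - n))
    (ξ : Bits r) (k : Bits m) : Matrix (E × MatPair n r m) (E × MatPair n r m) ℂ :=
  (1 / 2 ^ (n - r - m) : ℂ) • ∑ P : MatPair n r m, ∑ iI : Bits n,
    if iI ᵥ* P.1ᵀ = ξ ∧ iI ᵥ* P.2ᵀ = k then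
      (P.prob : ℂ) • (A.eveState b s hs iT jT iI ⊗ₖ Matrix.single P P 1)
    else 0

end Key

/-- The trace norm `tr |X|`, with `|X| = √(X† X)`. -/
def traceNorm {ι : Type*} [Fintype ι] [DecidableEq ι] (X : Matrix ι ι ℂ) : ℝ :=
  (CFC.abs X).trace.re

/-- The binary entropy function `H₂(x) = -x log₂ x - (1 - x) log₂ (1 - x)`. -/
def H₂ (x : ℝ) : ℝ := -x * Real.logb 2 x - (1 - x) * Real.logb 2 (1 - x)

end BB84

end

/-! Purify `ρ^{i_I}` by a system that records the error string, giving unit vectors `φ_i = ∑_d |d⟩ ⊗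
|E_{i,i+d}⟩`. Symmetrization averages over all masks `m`, and its signs depend only on the error
string, so the Gram matrix of the `φ_i` is unchanged when both indices are shifted by the same
string (`inner_purif_shift`). Its Fourier coefficients `η_l = 2^{-n} ∑_i (-1)^{i·l} φ_i` are
therefore orthogonal. Inverting the INFO basis is a Hadamard transform on the INFO qubits, so
`‖η_l‖²` is exactly the probability of error string `l` in the inverted protocol
(`invertedInfoErrorProb_symmetrize`).

The trace norm is attained by pairing with a unitary. Since the register is classical, only its
diagonal blocks `T_P`, which are contractions, contribute. For each `P` one must bound the sum of
`(-1)^{i·v} ⟨φ_i, T_P φ_i⟩` over a coset of the code. Expanding `φ_i = ∑_l (-1)^{i·l} η_l`, the pair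
`l, l'` carries the character sum of `l + l' + v` over the coset, which vanishes unless `l + l' + v`
lies in the row span of `P_C`. Keep as "good" the words of weight below `t` that are never confused
in this sense with a word of weight below `t`. Good pairs cancel, and the rest costs at most twice
the square root of the weight outside the good words (`norm_sum_sgn_inner_le`).

By concavity of the square root it remains to average that weight over `P`. A bad word either has
weight at least `t`, which gives the error probability, or is confused with one of at most `2^{n
H₂(t/n)}` light words. As `v` is uniform outside a space of at most `2^r ≤ 2^{n-1}` words, each
confusion has probability at most `2^{r+1-n}` (`sum_prob_mul_compl_goodWords_le`). -/

noncomputable section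

namespace BB84

open scoped Matrix Kronecker ComplexOrder MatrixOrder

/-! ### Characters of `F₂ⁿ`. -/

section Bits

lemma bits_add_self {n : ℕ} (x : Bits n) : x + x = 0 := by
  funext k
  exact CharTwo.add_self_eq_zero _

lemma bits_add_add_cancel {n : ℕ} (x y : Bits n) : x + y + y = x := by
  rw [add_assoc, bits_add_self, add_zero]

@[simp] lemma sgn_zero : sgn 0 = 1 := by simp [sgn]

@[simp] lemma sgn_one : sgn 1 = -1 := by
  have : (1 : ZMod 2).val = 1 := by decide
  simp [sgn, this]

@[simp] lemma norm_sgn (x : ZMod 2) : ‖sgn x‖ = 1 := by simp [sgn]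

lemma conj_sgn (x : ZMod 2) : (starRingEnd ℂ) (sgn x) = sgn x := star_sgn x

lemma eq_one_of_ne_zero {x : ZMod 2} (h : x ≠ 0) : x = 1 := by
  revert x; decide

lemma card_bits (n : ℕ) : Fintype.card (Bits n) = 2 ^ n := by simp

/-- A nonzero string is detected by a string that has odd overlap with it. -/
lemma exists_dotProduct_eq_one {n : ℕ} {l : Bits n} (hl : l ≠ 0) : ∃ a : Bits n, a ⬝ᵥ l = 1 := by
  obtain ⟨k, hk⟩ := Function.ne_iff.1 hl
  refine ⟨Pi.single k 1, ?_⟩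
  simpa using eq_one_of_ne_zero hk

lemma sum_sgn_dotProduct {n : ℕ} (l : Bits n) :
    ∑ i : Bits n, sgn (i ⬝ᵥ l) = if l = 0 then 2 ^ n else 0 := by
  split_ifs with h
  · subst h
    simp
  · obtain ⟨a, ha⟩ := exists_dotProduct_eq_one h
    have h1 : ∑ i : Bits n, sgn (i ⬝ᵥ l) = ∑ i : Bits n, sgn ((i + a) ⬝ᵥ l) :=
      (Equiv.sum_comp (Equiv.addRight a) fun i => sgn (i ⬝ᵥ l)).symm
    simp only [add_dotProduct, ha, sgn_add, sgn_one, mul_neg, mul_one,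
      Finset.sum_neg_distrib] at h1
    linear_combination h1 / 2

end Bits

/-! ### Linear codes, character sums over cosets, and random pairs of code and key vector. -/

section Codes

variable {n r : ℕ}

/-- The code spanned by the rows of a parity check matrix. -/
abbrev rowSpan (M : Matrix (Fin r) (Fin n) (ZMod 2)) : Submodule (ZMod 2) (Bits n) :=
  Submodule.span (ZMod 2) (Set.range M.row)

/-- Duality: a functional that kills the row span but not `w` is the inner product with some `u`. -/
lemma exists_dotProduct_of_notMem_rowSpan {M : Matrix (Fin r) (Fin n) (ZMod 2)} {w : Bits n}
    (hw : w ∉ rowSpan M) : ∃ u : Bits n, u ᵥ* Mᵀ = 0 ∧ u ⬝ᵥ w = 1 := by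
  obtain ⟨f, hf, hle⟩ := Submodule.exists_le_ker_of_notMem hw
  obtain ⟨u, rfl⟩ := (dotProductEquiv (ZMod 2) (Fin n)).surjective f
  refine ⟨u, ?_, eq_one_of_ne_zero (by simpa using hf)⟩
  funext k
  have := hle (Submodule.subset_span ⟨k, rfl⟩)
  have h0 : u ⬝ᵥ M.row k = 0 := by simpa using this
  rw [Matrix.vecMul_transpose]
  exact (dotProduct_comm _ _).trans h0

/-- The character sum over a coset of a code vanishes at words outside the dual code. -/
lemma sum_coset_sgn_eq_zero {M : Matrix (Fin r) (Fin n) (ZMod 2)} {w : Bits n}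
    (hw : w ∉ rowSpan M) (ξ : Bits r) :
    ∑ i : Bits n with i ᵥ* Mᵀ = ξ, sgn (i ⬝ᵥ w) = 0 := by
  obtain ⟨u, hu, huw⟩ := exists_dotProduct_of_notMem_rowSpan hw
  have h1 : ∑ i : Bits n with i ᵥ* Mᵀ = ξ, sgn (i ⬝ᵥ w) =
      ∑ i : Bits n with i ᵥ* Mᵀ = ξ, sgn ((i + u) ⬝ᵥ w) := by
    rw [Finset.sum_filter, Finset.sum_filter]
    rw [← Equiv.sum_comp (Equiv.addRight u)]
    refine Finset.sum_congr rfl fun i _ => ?_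
    simp [Matrix.add_vecMul, hu]
  simp only [add_dotProduct, huw, sgn_add, sgn_one, mul_neg, mul_one,
    Finset.sum_neg_distrib] at h1
  linear_combination h1 / 2

/-- Translation by one solution embeds the solution set into the kernel of `M`, whose dimension is
`n - r` by rank-nullity. -/
lemma card_coset_le {M : Matrix (Fin r) (Fin n) (ZMod 2)} (hM : LinearIndependent (ZMod 2) M.row)
    (ξ : Bits r) : (Finset.univ.filter fun i : Bits n => i ᵥ* Mᵀ = ξ).card ≤ 2 ^ (n - r) := by
  classical
  rcases (Finset.univ.filter fun i : Bits n => i ᵥ* Mᵀ = ξ).eq_empty_or_nonempty with h | ⟨i₀, h₀⟩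
  · simp [h]
  have hker : Fintype.card (LinearMap.ker M.mulVecLin) = 2 ^ (n - r) := by
    have h1 := LinearMap.finrank_range_add_finrank_ker M.mulVecLin
    have h2 : Module.finrank (ZMod 2) (LinearMap.range M.mulVecLin) = r := by
      simpa [Matrix.rank] using hM.rank_matrix
    rw [h2, Module.finrank_fin_fun] at h1
    rw [Module.card_eq_pow_finrank (K := ZMod 2), ZMod.card]
    congr 1
    omega
  rw [← hker, ← Fintype.card_coe]
  refine Fintype.card_le_of_injective
    (fun i => ⟨i.1 + i₀, ?_⟩) fun i j hij => ?_
  · have hi := i.2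
    simp only [Finset.mem_filter, Finset.mem_univ, true_and, Matrix.vecMul_transpose] at hi h₀
    rw [LinearMap.mem_ker, Matrix.mulVecLin_apply, Matrix.mulVec_add, hi, h₀, bits_add_self]
  · exact Subtype.ext (add_right_cancel (congrArg Subtype.val hij))

/-- The row of `P_K` that defines the one-bit key. -/
def MatPair.keyVec (P : MatPair n r 1) : Bits n := P.2 0

lemma MatPair.valid_iff (P : MatPair n r 1) :
    P.Valid ↔ LinearIndependent (ZMod 2) P.1.row ∧ P.keyVec ∉ rowSpan P.1 := by
  have h1 : (Matrix.fromRows P.1 P.2).row ∘ Sum.inl = P.1.row := rfl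
  have h2 : (Matrix.fromRows P.1 P.2).row ∘ Sum.inr = P.2.row := rfl
  rw [MatPair.Valid, linearIndependent_sum, h1, h2]
  refine and_congr_right fun _ => ?_
  have h3 : Set.range P.2.row = {P.keyVec} := by
    rw [Set.range_unique]; rfl
  have h4 : P.2.row default = P.keyVec := rfl
  rw [linearIndependent_unique_iff, h3, h4]
  -- Nonvanishing of the key vector follows from non-membership, because `0` lies in every span.
  constructor
  · rintro ⟨h, hd⟩ hm
    exact h (Submodule.disjoint_def.1 hd _ hm (Submodule.mem_span_singleton_self _))
  · intro h
    refine ⟨fun h0 => h (h0 ▸ Submodule.zero_mem _), ?_⟩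
    exact Submodule.disjoint_span_singleton.2 fun hm => absurd hm h

lemma natCard_rowSpan_le (M : Matrix (Fin r) (Fin n) (ZMod 2)) :
    Nat.card (rowSpan M) ≤ 2 ^ r := by
  classical
  rw [Nat.card_eq_fintype_card, Module.card_eq_pow_finrank (K := ZMod 2), ZMod.card]
  refine Nat.pow_le_pow_right (by norm_num) ?_
  exact (finrank_range_le_card (R := ZMod 2) M.row).trans_eq (Fintype.card_fin r)

open Classical in
lemma card_shift_rowSpan_le (M : Matrix (Fin r) (Fin n) (ZMod 2)) (c : Bits n) :
    (Finset.univ.filter fun v : Bits n => c + v ∈ rowSpan M).card ≤ 2 ^ r := by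
  refine le_trans ?_ (natCard_rowSpan_le M)
  rw [Nat.card_eq_fintype_card, ← Fintype.card_coe]
  refine Fintype.card_le_of_injective (fun v => ⟨c + v.1, (Finset.mem_filter.1 v.2).2⟩) ?_
  intro v w h
  exact Subtype.ext (add_left_cancel (congrArg Subtype.val h))

-- The span has at most `2^r ≤ 2^{n-1}` elements. This halving is the source of the exponent `r +
-- 1`, rather than `r`, in the final bound.
open Classical in
lemma card_filter_notMem_rowSpan_ge (hrn : r + 1 ≤ n) (M : Matrix (Fin r) (Fin n) (ZMod 2)) :
    2 ^ n ≤ 2 * (Finset.univ.filter fun v : Bits n => v ∉ rowSpan M).card := by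
  have h1 := Finset.card_filter_add_card_filter_not (s := (Finset.univ : Finset (Bits n)))
    (fun v : Bits n => v ∈ rowSpan M)
  have h2 := card_shift_rowSpan_le M 0
  simp only [zero_add] at h2
  rw [Finset.card_univ, card_bits] at h1
  have h3 : 2 ^ (r + 1) ≤ 2 ^ n := Nat.pow_le_pow_right (by norm_num) hrn
  rw [pow_succ] at h3
  omega

open Classical in
lemma card_filter_matPair (p : Matrix (Fin r) (Fin n) (ZMod 2) → Bits n → Prop) :
    (Finset.univ.filter fun P : MatPair n r 1 => p P.1 (P.keyVec)).card =
      ∑ M : Matrix (Fin r) (Fin n) (ZMod 2), (Finset.univ.filter fun v : Bits n => p M v).card := by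
  simp only [Finset.card_filter]
  rw [Fintype.sum_prod_type]
  refine Finset.sum_congr rfl fun M _ => ?_
  exact Fintype.sum_equiv (Equiv.funUnique (Fin 1) (Bits n)) _ _ fun K => rfl

open Classical in
/-- For a random key vector outside a random code, a given word is unlikely to be confused with one
of a given list of words. -/
lemma card_confused_le (hrn : r + 1 ≤ n) (L : Finset (Bits n)) (l : Bits n) :
    2 ^ n * (Finset.univ.filter fun P : MatPair n r 1 =>
        P.Valid ∧ ∃ l' ∈ L, l + l' + P.keyVec ∈ rowSpan P.1).card ≤
      L.card * 2 ^ (r + 1) * (Finset.univ.filter fun P : MatPair n r 1 => P.Valid).card := by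
  have e1 := card_filter_matPair fun (M : Matrix (Fin r) (Fin n) (ZMod 2)) v =>
    (LinearIndependent (ZMod 2) M.row ∧ v ∉ rowSpan M) ∧ ∃ l' ∈ L, l + l' + v ∈ rowSpan M
  have e2 := card_filter_matPair fun (M : Matrix (Fin r) (Fin n) (ZMod 2)) v =>
    LinearIndependent (ZMod 2) M.row ∧ v ∉ rowSpan M
  simp only [← MatPair.valid_iff] at e1 e2
  rw [e1, e2, Finset.mul_sum, Finset.mul_sum]
  refine Finset.sum_le_sum fun M _ => ?_
  by_cases hM : LinearIndependent (ZMod 2) M.row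
  · simp only [hM, true_and]
    have h1 : (Finset.univ.filter fun v : Bits n =>
        v ∉ rowSpan M ∧ ∃ l' ∈ L, l + l' + v ∈ rowSpan M).card ≤ L.card * 2 ^ r := by
      -- Union bound over `L`: for each `l'` the confusing key vectors form a translate of the row
      -- span.
      refine le_trans (Finset.card_le_card (t := L.biUnion fun l' =>
        Finset.univ.filter fun v : Bits n => l + l' + v ∈ rowSpan M) ?_) ?_
      · intro v hv
        simpa using (Finset.mem_filter.1 hv).2.2
      · exact Finset.card_biUnion_le_card_mul _ _ _ fun l' _ => card_shift_rowSpan_le M _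
    have h2 := card_filter_notMem_rowSpan_ge hrn M
    calc _ ≤ 2 ^ n * (L.card * 2 ^ r) := Nat.mul_le_mul_left _ h1
      _ ≤ (2 * (Finset.univ.filter fun v : Bits n => v ∉ rowSpan M).card) * (L.card * 2 ^ r) :=
          Nat.mul_le_mul_right _ h2
      _ = _ := by ring
  · simp [hM]

lemma MatPair.prob_nonneg (P : MatPair n r 1) : 0 ≤ P.prob := by
  unfold MatPair.prob
  split_ifs <;> positivity

lemma MatPair.valid_of_prob_ne_zero {P : MatPair n r 1} (h : P.prob ≠ 0) : P.Valid := by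
  by_contra hv
  exact h (by simp [MatPair.prob, hv])

open Classical in
lemma sum_prob_filter (p : MatPair n r 1 → Prop) [DecidablePred p] :
    ∑ P : MatPair n r 1, (if p P then P.prob else 0) =
      (Finset.univ.filter fun P : MatPair n r 1 => P.Valid ∧ p P).card /
        (Finset.univ.filter fun P : MatPair n r 1 => P.Valid).card := by
  simp only [MatPair.prob]
  have h : ∀ P : MatPair n r 1, ∀ x : ℝ, (if p P then (if P.Valid then x else 0) else 0) =
      if P.Valid ∧ p P then x else 0 := fun P x => by
    by_cases h1 : p P <;> by_cases h2 : P.Valid <;> simp [h1, h2]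
  simp only [h]
  rw [← Finset.sum_filter, Finset.sum_const, nsmul_eq_mul, mul_one_div]

lemma sum_prob_le_one : ∑ P : MatPair n r 1, P.prob ≤ 1 := by
  classical
  have h := sum_prob_filter (n := n) (r := r) fun _ => True
  simp only [if_true, and_true] at h
  rw [h]
  -- This also covers a zero denominator, so the existence of a valid pair is not needed.
  exact div_self_le_one _

open Classical in
lemma sum_prob_confused_le (hrn : r + 1 ≤ n) (L : Finset (Bits n)) (l : Bits n) :
    ∑ P : MatPair n r 1, (if ∃ l' ∈ L, l + l' + P.keyVec ∈ rowSpan P.1 then P.prob else 0) ≤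
      L.card * 2 ^ (r + 1) / 2 ^ n := by
  rw [sum_prob_filter fun P => ∃ l' ∈ L, l + l' + P.keyVec ∈ rowSpan P.1]
  refine div_le_of_le_mul₀ (by positivity) (by positivity) ?_
  rw [div_mul_eq_mul_div, le_div_iff₀ (by positivity), mul_comm]
  exact_mod_cast card_confused_le hrn L l

end Codes

/-! ### Entropy bound for Hamming balls. -/

section Entropy

/-- Total mass of the law of `n` independent bits, each equal to `1` with weight `x`. -/
lemma sum_prod_weight (n : ℕ) (x : ℝ) :
    ∑ l : Bits n, x ^ hammingNorm l * (1 - x) ^ (n - hammingNorm l) = 1 := by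
  classical
  have h := Finset.prod_univ_sum (fun _ : Fin n => (Finset.univ : Finset (ZMod 2)))
    fun _ z => if z ≠ 0 then x else 1 - x
  have h2 : ∑ z : ZMod 2, (if z ≠ 0 then x else 1 - x) = 1 := by
    have h3 : (Finset.univ : Finset (ZMod 2)) = {0, 1} := by decide
    rw [h3]
    simp
  simp only [h2, Finset.prod_const_one, Fintype.piFinset_univ] at h
  refine Eq.trans ?_ h.symm
  refine Finset.sum_congr rfl fun l _ => ?_
  rw [Finset.prod_ite, Finset.prod_const, Finset.prod_const]
  have h4 := Finset.card_filter_add_card_filter_not (s := (Finset.univ : Finset (Fin n)))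
    (fun k => l k ≠ 0)
  rw [Finset.card_univ, Fintype.card_fin] at h4
  have h5 : (Finset.univ.filter fun k => l k ≠ 0).card = hammingNorm l := rfl
  rw [h5] at h4 ⊢
  rw [Nat.sub_eq_of_eq_add' h4.symm]

/-- `2^{-n H₂(t/n)}` is the Bernoulli weight, with parameter `t/n`, of a single word of Hamming
weight `t`. -/
lemma two_rpow_entropy {n t : ℕ} (ht0 : 0 < t) (htn : t < n) :
    (2 : ℝ) ^ ((n : ℝ) * H₂ ((t : ℝ) / n)) *
      (((t : ℝ) / n) ^ t * (1 - (t : ℝ) / n) ^ (n - t)) = 1 := by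
  have hn : (0 : ℝ) < n := by exact_mod_cast ht0.trans htn
  have hx : (0 : ℝ) < (t : ℝ) / n := by positivity
  have hx1 : (0 : ℝ) < 1 - (t : ℝ) / n := by
    rw [sub_pos, div_lt_one hn]; exact_mod_cast htn
  have e1 : ((t : ℝ) / n) ^ t = (2 : ℝ) ^ (Real.logb 2 ((t : ℝ) / n) * t) := by
    rw [Real.rpow_mul (by norm_num), Real.rpow_logb (by norm_num) (by norm_num) hx,
      Real.rpow_natCast]
  have e2 : (1 - (t : ℝ) / n) ^ (n - t) =
      (2 : ℝ) ^ (Real.logb 2 (1 - (t : ℝ) / n) * (n - t : ℕ)) := by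
    rw [Real.rpow_mul (by norm_num), Real.rpow_logb (by norm_num) (by norm_num) hx1,
      Real.rpow_natCast]
  rw [e1, e2, ← Real.rpow_add (by norm_num), ← Real.rpow_add (by norm_num)]
  convert Real.rpow_zero (2 : ℝ) using 2
  rw [H₂, Nat.cast_sub htn.le]
  field_simp
  ring

/-- The size of a Hamming ball is at most `2 ^ (n H₂(t/n))`. -/
lemma card_hammingNorm_lt_le {n t : ℕ} (ht : (t : ℝ) ≤ n / 2) :
    ((Finset.univ.filter fun l : Bits n => hammingNorm l < t).card : ℝ) ≤
      (2 : ℝ) ^ ((n : ℝ) * H₂ ((t : ℝ) / n)) := by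
  -- For `t = 0` the ball is empty, since the inequality on the weight is strict.
  rcases Nat.eq_zero_or_pos t with rfl | ht0
  · simpa using Real.rpow_nonneg (by norm_num) _
  have ht0' : (0 : ℝ) < t := by exact_mod_cast ht0
  have hn : (0 : ℝ) < n := by linarith
  have htn : t < n := by
    have : (t : ℝ) < n := by linarith
    exact_mod_cast this
  set x : ℝ := (t : ℝ) / n with hx
  have hx0 : 0 < x := by positivity
  have hx2 : x ≤ 1 - x := by
    have : x ≤ 1 / 2 := by
      rw [hx, div_le_iff₀ hn]; linarith
    linarith
  set q : ℝ := x ^ t * (1 - x) ^ (n - t) with hq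
  have hq0 : 0 < q := by have : 0 < 1 - x := by linarith
                         positivity
  have hE := two_rpow_entropy ht0 htn
  rw [← hx, ← hq] at hE
  -- Each word lighter than `t` has Bernoulli weight at least `q`: replacing factors `x` by `1 - x ≥
  -- x` only increases it. The total weight is `1`.
  have hsum : ((Finset.univ.filter fun l : Bits n => hammingNorm l < t).card : ℝ) * q ≤ 1 := by
    rw [← sum_prod_weight n x, ← nsmul_eq_mul, ← Finset.sum_const]
    refine le_trans (Finset.sum_le_sum fun l hl => ?_)
      (Finset.sum_le_sum_of_subset_of_nonneg (Finset.filter_subset _ _) fun l _ _ => ?_)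
    · have hlt : hammingNorm l < t := (Finset.mem_filter.1 hl).2
      have h1 : x ^ t = x ^ hammingNorm l * x ^ (t - hammingNorm l) := by
        rw [← pow_add]; congr 1; omega
      have h2 : (1 - x) ^ (n - hammingNorm l) =
          (1 - x) ^ (t - hammingNorm l) * (1 - x) ^ (n - t) := by
        rw [← pow_add]; congr 1; omega
      rw [hq, h1, h2, mul_assoc]
      have : 0 ≤ 1 - x := by linarith
      gcongr
    · have : 0 ≤ 1 - x := by linarith
      positivity
  exact le_of_mul_le_mul_right (hsum.trans_eq hE.symm) hq0

end Entropy

/-! ### Variational form of the trace norm. -/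

section TraceNorm

variable {ι : Type*} [Fintype ι] [DecidableEq ι]

/-- The trace norm of a Hermitian matrix is attained by pairing with a unitary. -/
lemma exists_unitary_traceNorm_eq {X : Matrix ι ι ℂ} (hX : X.IsHermitian) :
    ∃ W ∈ Matrix.unitaryGroup ι ℂ, traceNorm X = (W * X).trace.re := by
  have hsa : IsSelfAdjoint X := hX
  -- The spectrum is finite, so even the discontinuous sign function is continuous on it.
  have hc : ∀ f : ℝ → ℝ, ContinuousOn f (spectrum ℝ X) := fun f =>
    (Matrix.finite_real_spectrum (A := X)).continuousOn f
  -- The value at `0` must be `±1` rather than `0`, so that the sign of `X` is unitary.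
  let sg : ℝ → ℝ := fun x => if 0 ≤ x then 1 else -1
  refine ⟨cfc sg X, ?_, ?_⟩
  · rw [Matrix.mem_unitaryGroup_iff, IsSelfAdjoint.star_eq (cfc_predicate sg X),
      ← cfc_mul sg sg X (hc _) (hc _)]
    have : (fun x => sg x * sg x) = fun _ => (1 : ℝ) := by
      funext x
      simp only [sg]
      split_ifs <;> norm_num
    rw [this, cfc_const_one ℝ X]
  · have h1 : cfc sg X * X = CFC.abs X := by
      rw [CFC.abs_eq_cfc_norm X hsa]
      nth_rw 2 [← cfc_id' ℝ X hsa]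
      rw [← cfc_mul sg (fun x => x) X (hc _) (hc _)]
      congr 1
      funext x
      simp only [sg, Real.norm_eq_abs]
      split_ifs with h
      · rw [abs_of_nonneg h, one_mul]
      · rw [abs_of_neg (not_le.1 h), neg_one_mul]
    rw [h1, traceNorm]

lemma norm_sq_mulVec_of_unitary {W : Matrix ι ι ℂ} (hW : W ∈ Matrix.unitaryGroup ι ℂ)
    (x : ι → ℂ) : ∑ a, ‖(W *ᵥ x) a‖ ^ 2 = ∑ a, ‖x a‖ ^ 2 := by
  have h : ∀ y : ι → ℂ, ((∑ a, ‖y a‖ ^ 2 : ℝ) : ℂ) = star y ⬝ᵥ y := fun y => by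
    push_cast
    exact Finset.sum_congr rfl fun a _ => (Complex.conj_mul' (y a)).symm
  have h2 : star (W *ᵥ x) ⬝ᵥ (W *ᵥ x) = star x ⬝ᵥ x := by
    rw [Matrix.star_mulVec, Matrix.dotProduct_mulVec, Matrix.vecMul_vecMul,
      ← Matrix.star_eq_conjTranspose, Matrix.mem_unitaryGroup_iff'.1 hW, Matrix.vecMul_one]
  exact_mod_cast (h _).trans (h2.trans (h _).symm)

end TraceNorm

/-! ### Diagonal blocks of an operator over the classical register. -/

section Blocks

variable {D K Q : Type*} [Fintype D] [Fintype K]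

/-- The `(Q, Q)` block of a matrix on `K × Q`, acting on the second factor of `D × K`. -/
def blockMap (D : Type*) [Fintype D] (W : Matrix (K × Q) (K × Q) ℂ) (P : Q) :
    EuclideanSpace ℂ (D × K) →ₗ[ℂ] EuclideanSpace ℂ (D × K) where
  toFun y := WithLp.toLp 2 fun p => ∑ k, W (p.2, P) (k, P) * y (p.1, k)
  map_add' x y := by
    ext p
    simp [mul_add, Finset.sum_add_distrib]
  map_smul' c x := by
    ext p
    simp [Finset.mul_sum, mul_left_comm]

lemma blockMap_apply (W : Matrix (K × Q) (K × Q) ℂ) (P : Q) (y : EuclideanSpace ℂ (D × K))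
    (p : D × K) : blockMap D W P y p = ∑ k, W (p.2, P) (k, P) * y (p.1, k) := rfl

variable [Fintype Q] [DecidableEq Q]

/-- Pairing with a mixed state tensored with a classical state of the register. -/
lemma trace_mul_kronecker_single (W : Matrix (K × Q) (K × Q) ℂ) (P : Q) (u : D → K → ℂ) :
    (W * ((∑ d, Matrix.vecMulVec (u d) (star (u d))) ⊗ₖ Matrix.single P P (1 : ℂ))).trace =
      inner ℂ (WithLp.toLp 2 fun p : D × K => u p.1 p.2)
        (blockMap D W P (WithLp.toLp 2 fun p : D × K => u p.1 p.2)) := by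
  rw [PiLp.inner_apply, Fintype.sum_prod_type]
  simp only [blockMap_apply, Matrix.trace, Matrix.diag_apply, Matrix.mul_apply,
    Fintype.sum_prod_type, Matrix.kroneckerMap_apply, Matrix.sum_apply, Matrix.vecMulVec_apply,
    Pi.star_apply, RCLike.inner_apply]
  have h1 : ∀ (k k' : K) (q : Q), ∑ q', W (k, q) (k', q') *
      ((∑ d, u d k' * star (u d k)) * Matrix.single P P (1 : ℂ) q' q) =
      if q = P then W (k, P) (k', P) * ∑ d, u d k' * star (u d k) else 0 := by
    intro k k' q
    rw [Finset.sum_eq_single P]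
    · by_cases h : q = P
      · subst h; simp
      · simp [h, Ne.symm h]
    · intro q' _ hq'
      simp [hq'.symm]
    · simp
  simp only [h1]
  have h2 : ∀ k : K, ∑ q : Q, ∑ k' : K,
      (if q = P then W (k, P) (k', P) * ∑ d, u d k' * star (u d k) else 0) =
      ∑ k' : K, W (k, P) (k', P) * ∑ d, u d k' * star (u d k) := by
    intro k
    rw [Finset.sum_eq_single P] <;> simp +contextual
  simp only [h2]
  simp only [Finset.mul_sum, Finset.sum_mul]
  have h3 : ∀ k : K, ∑ k' : K, ∑ d, W (k, P) (k', P) * (u d k' * star (u d k)) =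
      ∑ d, ∑ k' : K, W (k, P) (k', P) * (u d k' * star (u d k)) := fun k => Finset.sum_comm
  simp only [h3]
  rw [Finset.sum_comm]
  simp only [mul_assoc, Complex.star_def]

variable [DecidableEq K]

lemma norm_blockMap_le {W : Matrix (K × Q) (K × Q) ℂ}
    (hW : W ∈ Matrix.unitaryGroup (K × Q) ℂ) (P : Q) (y : EuclideanSpace ℂ (D × K)) :
    ‖blockMap D W P y‖ ≤ ‖y‖ := by
  refine le_of_sq_le_sq ?_ (norm_nonneg _)
  rw [EuclideanSpace.norm_sq_eq, EuclideanSpace.norm_sq_eq, Fintype.sum_prod_type,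
    Fintype.sum_prod_type]
  refine Finset.sum_le_sum fun d _ => ?_
  -- Extending by zero off the register value `P` makes the block a piece of `W *ᵥ z`; dropping the
  -- other components only decreases the norm.
  set z : K × Q → ℂ := fun q => if q.2 = P then y (d, q.1) else 0 with hz
  have h1 : ∑ q, ‖z q‖ ^ 2 = ∑ k, ‖y (d, k)‖ ^ 2 := by
    rw [Fintype.sum_prod_type]
    refine Finset.sum_congr rfl fun k _ => ?_
    rw [Finset.sum_eq_single P] <;> simp +contextual [hz]
  have h2 : ∀ k, blockMap D W P y (d, k) = (W *ᵥ z) (k, P) := by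
    intro k
    rw [blockMap_apply, Matrix.mulVec, dotProduct, Fintype.sum_prod_type]
    refine Finset.sum_congr rfl fun k' _ => ?_
    rw [Finset.sum_eq_single P] <;> simp +contextual [hz]
  rw [← h1, ← norm_sq_mulVec_of_unitary hW z, Fintype.sum_prod_type]
  refine Finset.sum_le_sum fun k _ => ?_
  rw [h2]
  exact Finset.single_le_sum (f := fun q => ‖(W *ᵥ z) (k, q)‖ ^ 2) (fun _ _ => by positivity)
    (Finset.mem_univ P)

end Blocks

/-! ### Fourier analysis of shift-invariant families of vectors. -/

section Core

variable {n : ℕ} {V : Type*} [NormedAddCommGroup V] [InnerProductSpace ℂ V]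

/-- The Fourier coefficients of a family of vectors indexed by bitstrings. -/
def fourierVec (φ : Bits n → V) (l : Bits n) : V :=
  ((2 : ℂ) ^ n)⁻¹ • ∑ i, sgn (i ⬝ᵥ l) • φ i

lemma sum_fourierVec (φ : Bits n → V) (i : Bits n) :
    ∑ l, sgn (i ⬝ᵥ l) • fourierVec φ l = φ i := by
  have h : ∀ j : Bits n, ∑ l : Bits n, (sgn (i ⬝ᵥ l) * (((2 : ℂ) ^ n)⁻¹ * sgn (j ⬝ᵥ l))) • φ j =
      (if i = j then (1 : ℂ) else 0) • φ j := by
    intro j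
    rw [← Finset.sum_smul]
    congr 1
    have h1 := sum_sgn_dotProduct (i + j)
    have h2 : i + j = 0 ↔ i = j :=
      ⟨fun h => by rw [← bits_add_add_cancel i j, h, zero_add], fun h => h ▸ bits_add_self _⟩
    simp only [h2, dotProduct_comm _ (i + j), add_dotProduct, sgn_add] at h1
    simp only [mul_left_comm (sgn _), ← Finset.mul_sum, h1]
    split_ifs
    · exact inv_mul_cancel₀ (by positivity)
    · exact mul_zero _
  simp only [fourierVec, Finset.smul_sum, smul_smul]
  rw [Finset.sum_comm]
  simp [h]

/-- Shifting both indices by an `a` with `a · (l + l') = 1` preserves the Gram matrix and reverses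
the sign of the double sum. -/
lemma inner_fourierVec_eq_zero {φ : Bits n → V}
    (hφ : ∀ a i i', (inner ℂ (φ (i + a)) (φ (i' + a)) : ℂ) = inner ℂ (φ i) (φ i'))
    {l l' : Bits n} (hl : l ≠ l') :
    (inner ℂ (fourierVec φ l) (fourierVec φ l') : ℂ) = 0 := by
  have hne : l + l' ≠ 0 := fun h => hl (by
    rw [← bits_add_add_cancel l l', h, zero_add])
  obtain ⟨a, ha⟩ := exists_dotProduct_eq_one hne
  have hs : sgn (a ⬝ᵥ l) * sgn (a ⬝ᵥ l') = -1 := by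
    rw [← sgn_add, ← dotProduct_add, ha, sgn_one]
  simp only [fourierVec, inner_smul_left, inner_smul_right, sum_inner, inner_sum, conj_sgn]
  set X : ℂ := ∑ i, ∑ j, sgn (j ⬝ᵥ l') * (sgn (i ⬝ᵥ l) * inner ℂ (φ i) (φ j)) with hX
  have h0 : X = -X := by
    conv_lhs => rw [hX]
    rw [← Equiv.sum_comp (Equiv.addRight a), hX, ← Finset.sum_neg_distrib]
    refine Finset.sum_congr rfl fun i _ => ?_
    rw [← Equiv.sum_comp (Equiv.addRight a), ← Finset.sum_neg_distrib]
    refine Finset.sum_congr rfl fun j _ => ?_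
    simp only [Equiv.coe_addRight, hφ, add_dotProduct, sgn_add]
    linear_combination sgn (j ⬝ᵥ l') * sgn (i ⬝ᵥ l) * inner ℂ (φ i) (φ j) * hs
  have hX0 : X = 0 := by linear_combination h0 / 2
  have h3 : (∑ i, sgn (i ⬝ᵥ l') * ∑ j, sgn (j ⬝ᵥ l) * inner ℂ (φ j) (φ i)) = X := by
    rw [hX, Finset.sum_comm]
    simp only [Finset.mul_sum]
  simp only [mul_left_comm _ ((starRingEnd ℂ) _)]
  rw [← Finset.mul_sum, h3, hX0, mul_zero, mul_zero]

/-- Pythagoras for the orthogonal Fourier coefficients. The value does not depend on `i`, so the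
good and bad parts have the same norm for every `i`. -/
lemma norm_sq_sum_fourierVec {φ : Bits n → V}
    (hφ : ∀ a i i', (inner ℂ (φ (i + a)) (φ (i' + a)) : ℂ) = inner ℂ (φ i) (φ i'))
    (S : Finset (Bits n)) (i : Bits n) :
    ‖∑ l ∈ S, sgn (i ⬝ᵥ l) • fourierVec φ l‖ ^ 2 = ∑ l ∈ S, ‖fourierVec φ l‖ ^ 2 := by
  classical
  have h : (inner ℂ (∑ l ∈ S, sgn (i ⬝ᵥ l) • fourierVec φ l)
      (∑ l ∈ S, sgn (i ⬝ᵥ l) • fourierVec φ l) : ℂ) = ∑ l ∈ S, (‖fourierVec φ l‖ ^ 2 : ℂ) := by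
    rw [sum_inner]
    refine Finset.sum_congr rfl fun l hl => ?_
    rw [inner_sum, Finset.sum_eq_single l]
    · rw [inner_smul_left, inner_smul_right, conj_sgn, ← mul_assoc, sgn_mul_self, one_mul,
        inner_self_eq_norm_sq_to_K]
      rfl
    · intro l' _ hl'
      rw [inner_smul_left, inner_smul_right, inner_fourierVec_eq_zero hφ hl'.symm, mul_zero,
        mul_zero]
    · exact fun h => absurd hl h
  rw [inner_self_eq_norm_sq_to_K] at h
  refine Complex.ofReal_injective ?_
  push_cast
  exact h

/-- If the sign `(-1) ^ (i·v)` is balanced on every pair of frequencies of `G`, then the signed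
average of the expectations of a contraction is controlled by the weight outside `G`. -/
lemma norm_sum_sgn_inner_le {φ : Bits n → V}
    (hφ : ∀ a i i', (inner ℂ (φ (i + a)) (φ (i' + a)) : ℂ) = inner ℂ (φ i) (φ i'))
    (hnorm : ∀ i, ‖φ i‖ = 1) (T : V →ₗ[ℂ] V) (hT : ∀ y, ‖T y‖ ≤ ‖y‖)
    (S G : Finset (Bits n)) (v : Bits n)
    (hG : ∀ l ∈ G, ∀ l' ∈ G, ∑ i ∈ S, sgn (i ⬝ᵥ (l + l' + v)) = 0) :
    ‖∑ i ∈ S, sgn (i ⬝ᵥ v) * inner ℂ (φ i) (T (φ i))‖ ≤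
      S.card * (2 * Real.sqrt (∑ l ∈ Gᶜ, ‖fourierVec φ l‖ ^ 2)) := by
  set good : Bits n → V := fun i => ∑ l ∈ G, sgn (i ⬝ᵥ l) • fourierVec φ l with hgood
  set bad : Bits n → V := fun i => ∑ l ∈ Gᶜ, sgn (i ⬝ᵥ l) • fourierVec φ l with hbad
  have hsplit : ∀ i, φ i = good i + bad i := fun i => by
    rw [hgood, hbad, Finset.sum_add_sum_compl, sum_fourierVec]
  have hbn : ∀ i, ‖bad i‖ = Real.sqrt (∑ l ∈ Gᶜ, ‖fourierVec φ l‖ ^ 2) := fun i => by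
    rw [← norm_sq_sum_fourierVec hφ Gᶜ i, Real.sqrt_sq (norm_nonneg _)]
  have hgn : ∀ i, ‖good i‖ ≤ 1 := fun i => by
    refine le_of_sq_le_sq ?_ zero_le_one
    rw [one_pow, norm_sq_sum_fourierVec hφ G i]
    have h1 := norm_sq_sum_fourierVec hφ Finset.univ i
    rw [sum_fourierVec, hnorm, one_pow] at h1
    rw [h1]
    exact Finset.sum_le_sum_of_subset_of_nonneg (Finset.subset_univ _) fun _ _ _ => by positivity
  -- Cross terms inside `G` carry the balanced character sums and cancel exactly.
  have hgg : ∑ i ∈ S, sgn (i ⬝ᵥ v) * (inner ℂ (good i) (T (good i)) : ℂ) = 0 := by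
    have h1 : ∀ i, sgn (i ⬝ᵥ v) * (inner ℂ (good i) (T (good i)) : ℂ) =
        ∑ l ∈ G, ∑ l' ∈ G, sgn (i ⬝ᵥ (l + l' + v)) *
          inner ℂ (fourierVec φ l) (T (fourierVec φ l')) := by
      intro i
      simp only [hgood, map_sum, map_smul, sum_inner, inner_sum, inner_smul_left,
        inner_smul_right, conj_sgn, Finset.mul_sum, dotProduct_add, sgn_add]
      rw [Finset.sum_comm]
      refine Finset.sum_congr rfl fun l _ => Finset.sum_congr rfl fun l' _ => ?_
      ring
    simp only [h1]
    rw [Finset.sum_comm]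
    refine Finset.sum_eq_zero fun l hl => ?_
    rw [Finset.sum_comm]
    refine Finset.sum_eq_zero fun l' hl' => ?_
    rw [← Finset.sum_mul, hG l hl l' hl', zero_mul]
  -- Removing the vanishing good-good part leaves two terms per `i`, each containing one bad factor;
  -- hence the constant `2`.
  have hsum : ∑ i ∈ S, sgn (i ⬝ᵥ v) * (inner ℂ (φ i) (T (φ i)) : ℂ) =
      ∑ i ∈ S, sgn (i ⬝ᵥ v) *
        (inner ℂ (bad i) (T (φ i)) + inner ℂ (good i) (T (bad i)) : ℂ) := by
    rw [← sub_eq_zero, ← Finset.sum_sub_distrib, ← hgg]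
    refine Finset.sum_congr rfl fun i _ => ?_
    rw [hsplit i, map_add, inner_add_left, inner_add_right, inner_add_right]
    ring
  rw [hsum, ← nsmul_eq_mul, ← Finset.sum_const]
  refine norm_sum_le_of_le _ fun i _ => ?_
  rw [norm_mul, norm_sgn, one_mul, two_mul]
  refine (norm_add_le _ _).trans (add_le_add ?_ ?_)
  · calc _ ≤ ‖bad i‖ * ‖T (φ i)‖ := norm_inner_le_norm _ _
      _ ≤ ‖bad i‖ * 1 := by gcongr; exact (hT _).trans_eq (hnorm i)
      _ = _ := by rw [mul_one, hbn]
  · calc _ ≤ ‖good i‖ * ‖T (bad i)‖ := norm_inner_le_norm _ _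
      _ ≤ 1 * ‖bad i‖ := by gcongr; exacts [hgn i, hT _]
      _ = _ := by rw [one_mul, hbn]

end Core

/-! ### Eve's vectors under symmetrization. -/

section SymmetrizedAttack

variable {N : ℕ} {E : Type*} [Fintype E]

lemma liftU_mulVec (U : Matrix (E × Bits N) (E × Bits N) ℂ)
    (ψ : (E × Bits N) × Bits N → ℂ) (e : E) (m x : Bits N) :
    (liftU U *ᵥ ψ) ((e, m), x) = (U *ᵥ fun y => ψ ((y.1, m), y.2)) (e, x) := by
  have h : ∀ e' m' x', liftU U ((e, m), x) ((e', m'), x') =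
      U (e, x) (e', x') * (1 : Matrix (Bits N) (Bits N) ℂ) m m' := fun _ _ _ => rfl
  simp only [Matrix.mulVec, dotProduct, Fintype.sum_prod_type, h]
  refine Finset.sum_congr rfl fun e' _ => ?_
  rw [Finset.sum_eq_single m]
  · simp
  · intro m' _ hm
    simp [Matrix.one_apply_ne hm.symm]
  · simp

variable [DecidableEq E]

lemma symS_apply_eq (N : ℕ) (m x m' x' : Bits N) :
    symS N (m, x) (m', x') = if m = m' ∧ x = x' + m' then sgn (x' ⬝ᵥ m') else 0 := rfl

lemma liftS_apply (e e' : E) (m m' x x' : Bits N) :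
    liftS N E ((e, m), x) ((e', m'), x') = (1 : Matrix E E ℂ) e e' * symS N (m, x) (m', x') := rfl

lemma liftS_mulVec (ψ : (E × Bits N) × Bits N → ℂ) (e : E) (m x : Bits N) :
    (liftS N E *ᵥ ψ) ((e, m), x) = sgn ((x + m) ⬝ᵥ m) * ψ ((e, m), x + m) := by
  rw [Matrix.mulVec, dotProduct, Finset.sum_eq_single ((e, m), x + m)]
  · rw [liftS_apply, symS_apply_eq, bits_add_add_cancel]
    simp
  · rintro ⟨⟨e', m'⟩, x'⟩ - hne
    rw [liftS_apply, symS_apply_eq]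
    by_cases he : e = e'
    · rw [if_neg, mul_zero, zero_mul]
      rintro ⟨rfl, rfl⟩
      exact hne (by rw [he, bits_add_add_cancel])
    · rw [Matrix.one_apply_ne he, zero_mul, zero_mul]
  · simp

lemma liftS_conjTranspose_mulVec (ψ : (E × Bits N) × Bits N → ℂ) (e : E) (m x : Bits N) :
    ((liftS N E)ᴴ *ᵥ ψ) ((e, m), x) = sgn (x ⬝ᵥ m) * ψ ((e, m), x + m) := by
  rw [Matrix.mulVec, dotProduct, Finset.sum_eq_single ((e, m), x + m)]
  · rw [Matrix.conjTranspose_apply, liftS_apply, symS_apply_eq]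
    simp [conj_sgn]
  · rintro ⟨⟨e', m'⟩, x'⟩ - hne
    rw [Matrix.conjTranspose_apply, liftS_apply, symS_apply_eq]
    by_cases he : e' = e
    · rw [if_neg, mul_zero, star_zero, zero_mul]
      rintro ⟨rfl, rfl⟩
      exact hne (by rw [he])
    · rw [Matrix.one_apply_ne he, zero_mul, star_zero, zero_mul]
  · simp

/-- Coordinate form of `symS_mulVec`: the action of `S` in the basis `b` becomes a shift with a
phase. -/
lemma ket_shift (b i m x : Bits N) :
    sgn ((x + m) ⬝ᵥ m) * ket b i (x + m) = sgn ((i + b) ⬝ᵥ m) * ket b (i + m) x := by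
  have h := congrFun (symS_mulVec b i m) (m, x)
  rw [Matrix.mulVec, dotProduct, Finset.sum_eq_single (m, x + m)] at h
  · rw [symS_apply_eq, bits_add_add_cancel] at h
    simpa using h
  · rintro ⟨m', x'⟩ - hne
    rw [symS_apply_eq]
    by_cases hm : m' = m
    · rw [if_neg, zero_mul]
      rintro ⟨-, rfl⟩
      exact hne (by rw [hm, bits_add_add_cancel])
    · simp [hm]
  · simp

/-- Eve's states for the symmetrized attack, in terms of those for the original attack. -/
lemma JointAttack.eveVec_symmetrize (A : JointAttack N E) (b i j : Bits N) (e : E) (m : Bits N) :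
    A.symmetrize.eveVec b i j (e, m) =
      1 / (Real.sqrt (2 ^ N) : ℂ) * (sgn ((i + j) ⬝ᵥ m) * A.eveVec b (i + m) (j + m) e) := by
  set c : ℂ := 1 / (Real.sqrt (2 ^ N) : ℂ) with hc
  set w : E × Bits N → ℂ := A.U *ᵥ fun y => A.probe y.1 * ket b (i + m) y.2 with hw
  have hin : ∀ x, (A.symmetrize.U *ᵥ fun y => A.symmetrize.probe y.1 * ket b i y.2) ((e, m), x) =
      sgn (x ⬝ᵥ m) * (c * sgn ((i + b) ⬝ᵥ m) * w (e, x + m)) := by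
    intro x
    have hU : A.symmetrize.U = (liftS N E)ᴴ * liftU A.U * liftS N E := rfl
    rw [hU, ← Matrix.mulVec_mulVec, ← Matrix.mulVec_mulVec, liftS_conjTranspose_mulVec,
      liftU_mulVec]
    congr 1
    have h1 : (fun y : E × Bits N => (liftS N E *ᵥ fun y : (E × Bits N) × Bits N =>
        A.symmetrize.probe y.1 * ket b i y.2) ((y.1, m), y.2)) =
        (c * sgn ((i + b) ⬝ᵥ m)) • fun y : E × Bits N => A.probe y.1 * ket b (i + m) y.2 := by
      funext y
      have h2 : A.symmetrize.probe (y.1, m) = A.probe y.1 * c := rfl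
      rw [liftS_mulVec, h2, Pi.smul_apply, smul_eq_mul]
      linear_combination A.probe y.1 * c * ket_shift b i m y.2
    rw [h1, Matrix.mulVec_smul, Pi.smul_apply, smul_eq_mul]
  unfold JointAttack.eveVec
  simp only [hin]
  rw [← Equiv.sum_comp (Equiv.addRight m)]
  simp only [Equiv.coe_addRight, bits_add_add_cancel, Finset.mul_sum]
  refine Finset.sum_congr rfl fun x _ => ?_
  have h3 := congrArg star (ket_shift b j m x)
  simp only [StarMul.star_mul, star_sgn] at h3
  -- The phases `b · m` from preparation and measurement cancel, leaving a sign that depends only on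
  -- the error string.
  have h4 : sgn ((i + j) ⬝ᵥ m) = sgn ((j + b) ⬝ᵥ m) * sgn ((i + b) ⬝ᵥ m) := by
    rw [← sgn_add, ← add_dotProduct]
    congr 2
    rw [add_add_add_comm, bits_add_self, add_zero, add_comm]
  rw [h4]
  linear_combination c * sgn ((i + b) ⬝ᵥ m) * w (e, x) * h3

/-- The Gram matrix of Eve's states for a symmetrized attack is invariant under flips of Alice's and
Bob's strings. -/
lemma JointAttack.gram_symmetrize_shift (A : JointAttack N E) (b i j i' j' u : Bits N)
    (h : i + j = i' + j') :
    ∑ e, star (A.symmetrize.eveVec b (i + u) (j + u) e) *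
        A.symmetrize.eveVec b (i' + u) (j' + u) e =
      ∑ e, star (A.symmetrize.eveVec b i j e) * A.symmetrize.eveVec b i' j' e := by
  -- Equal error strings give equal signs, which square to `1`; the Gram entry becomes a plain
  -- average over masks.
  have key : ∀ i j i' j' : Bits N, i + j = i' + j' →
      ∑ e, star (A.symmetrize.eveVec b i j e) * A.symmetrize.eveVec b i' j' e =
      ∑ m, ∑ e, (star (1 / (Real.sqrt (2 ^ N) : ℂ)) * (1 / (Real.sqrt (2 ^ N) : ℂ))) *
        (star (A.eveVec b (i + m) (j + m) e) * A.eveVec b (i' + m) (j' + m) e) := by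
    intro i j i' j' h
    rw [Fintype.sum_prod_type, Finset.sum_comm]
    refine Finset.sum_congr rfl fun m _ => Finset.sum_congr rfl fun e _ => ?_
    rw [A.eveVec_symmetrize, A.eveVec_symmetrize, h]
    simp only [StarMul.star_mul, star_sgn]
    linear_combination star (1 / (Real.sqrt (2 ^ N) : ℂ)) * (1 / (Real.sqrt (2 ^ N) : ℂ)) *
      (star (A.eveVec b (i + m) (j + m) e) * A.eveVec b (i' + m) (j' + m) e) *
        sgn_mul_self ((i' + j') ⬝ᵥ m)
  have hx : ∀ x y : Bits N, x + u + (y + u) = x + y := fun x y => by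
    rw [add_add_add_comm, bits_add_self, add_zero]
  -- The common shift `u` is absorbed by translating the mask `m`.
  rw [key _ _ _ _ h, key _ _ _ _ (by rw [hx, hx, h]), ← Equiv.sum_comp (Equiv.addLeft u)]
  simp only [Equiv.coe_addLeft, add_assoc, ← add_assoc u u, bits_add_self, zero_add]

lemma JointAttack.bornProb_symmetrize_shift (A : JointAttack N E) (b i j u : Bits N) :
    A.symmetrize.bornProb b (i + u) (j + u) = A.symmetrize.bornProb b i j := by
  have h : ∀ i j, (A.symmetrize.bornProb b i j : ℂ) =
      ∑ e, star (A.symmetrize.eveVec b i j e) * A.symmetrize.eveVec b i j e := by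
    intro i j
    rw [JointAttack.bornProb]
    push_cast
    exact Finset.sum_congr rfl fun e _ => (Complex.conj_mul' _).symm
  refine Complex.ofReal_injective ?_
  rw [h, h, A.gram_symmetrize_shift b i j i j u rfl]

end SymmetrizedAttack

/-! ### INFO and TEST positions, and the change of basis on the INFO qubits. -/

section Join

variable {N n : ℕ} (s : Bits N) (hs : hammingNorm s = n)

lemma join_infoPos (xI : Bits n) (xT : Bits (N - n)) (a : Fin n) :
    join s hs xI xT (infoPos s hs a) = xI a := by
  rw [join, dif_pos (infoPos s hs a).2]
  simp

lemma join_testPos (xI : Bits n) (xT : Bits (N - n)) (a : Fin (N - n)) :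
    join s hs xI xT (testPos s hs a) = xT a := by
  rw [join, dif_neg (testPos s hs a).2]
  simp

lemma join_add (xI yI : Bits n) (xT yT : Bits (N - n)) :
    join s hs (xI + yI) (xT + yT) = join s hs xI xT + join s hs yI yT := by
  funext k
  simp only [join, Pi.add_apply]
  split_ifs <;> rfl

lemma join_add_zero (xI yI : Bits n) (xT : Bits (N - n)) :
    join s hs (xI + yI) xT = join s hs xI xT + join s hs yI 0 := by
  rw [← join_add, add_zero]

lemma ket_join (b : Bits N) (iI : Bits n) (iT : Bits (N - n)) (x : Bits N) :
    ket b (join s hs iI iT) x =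
      (∏ a : Fin n, qubitKet (b (infoPos s hs a)) (iI a) (x (infoPos s hs a))) *
        ∏ a : Fin (N - n), qubitKet (b (testPos s hs a)) (iT a) (x (testPos s hs a)) := by
  rw [ket, ← Fintype.prod_subtype_mul_prod_subtype (fun k => s k ≠ 0),
    ← Equiv.prod_comp (infoPos s hs), ← Equiv.prod_comp (testPos s hs)]
  simp only [join_infoPos, join_testPos]

/-- The Hadamard transform is its own inverse, so one formula serves both directions of the basis
change. -/
lemma qubitKet_add_one (b i x : ZMod 2) :
    qubitKet (b + 1) i x = ∑ i' : ZMod 2, 1 / (Real.sqrt 2 : ℂ) * sgn (i * i') * qubitKet b i' x := by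
  have hval : ∀ x : ZMod 2, x = 0 ∨ x = 1 := by decide
  have h11 : (1 : ZMod 2) + 1 = 0 := by decide
  have hu : (Finset.univ : Finset (ZMod 2)) = {0, 1} := by decide
  have hsq : (Real.sqrt 2 : ℂ) * (Real.sqrt 2 : ℂ) = 2 := by
    exact_mod_cast congrArg (fun x : ℝ => (x : ℂ)) (Real.mul_self_sqrt (by norm_num : (0 : ℝ) ≤ 2))
  have h0 : (Real.sqrt 2 : ℂ) ≠ 0 := fun h => by simp [h] at hsq
  rw [hu, Finset.sum_pair (by decide)]
  rcases hval b with rfl | rfl <;> rcases hval i with rfl | rfl <;>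
    rcases hval x with rfl | rfl <;>
    simp [qubitKet, h11] <;> field_simp <;>
    first | linear_combination hsq | ring

lemma ket_inverted (b : Bits N) (iI : Bits n) (iT : Bits (N - n)) (x : Bits N) :
    ket (b + s) (join s hs iI iT) x =
      ∑ i' : Bits n, (1 / (Real.sqrt 2 : ℂ)) ^ n * sgn (iI ⬝ᵥ i') * ket b (join s hs i' iT) x := by
  have hI : ∀ a, (b + s) (infoPos s hs a) = b (infoPos s hs a) + 1 := fun a => by
    rw [Pi.add_apply, eq_one_of_ne_zero (infoPos s hs a).2]
  have hT : ∀ a, (b + s) (testPos s hs a) = b (testPos s hs a) := fun a => by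
    rw [Pi.add_apply, not_not.1 (testPos s hs a).2, add_zero]
  simp only [ket_join, hI, hT, qubitKet_add_one]
  rw [Finset.prod_univ_sum, Fintype.piFinset_univ, Finset.sum_mul]
  refine Finset.sum_congr rfl fun i' _ => ?_
  rw [Finset.prod_mul_distrib, Finset.prod_mul_distrib, Finset.prod_const, Finset.card_univ,
    Fintype.card_fin, dotProduct, sgn_sum, mul_assoc _ (Finset.prod _ _) (Finset.prod _ _)]

end Join

/-! ### Eve's vectors when the INFO basis is inverted. -/

section InvertedBasis

variable {N n : ℕ} {E : Type*} [Fintype E] [DecidableEq E]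

/-- Alice's and Bob's Hadamard transforms each contribute `2^{-n/2}`. -/
lemma JointAttack.eveVec_inverted (A : JointAttack N E) (b s : Bits N) (hs : hammingNorm s = n)
    (iI jI : Bits n) (iT jT : Bits (N - n)) (e : E) :
    A.eveVec (b + s) (join s hs iI iT) (join s hs jI jT) e =
      ((2 : ℂ) ^ n)⁻¹ * ∑ i' : Bits n, ∑ j' : Bits n, sgn (iI ⬝ᵥ i') * sgn (jI ⬝ᵥ j') *
        A.eveVec b (join s hs i' iT) (join s hs j' jT) e := by
  set c : ℂ := (1 / (Real.sqrt 2 : ℂ)) ^ n with hc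
  have hstar : star c = c := by
    simp [hc]
  have hcc : c * c = ((2 : ℂ) ^ n)⁻¹ := by
    have hsq : (Real.sqrt 2 : ℂ) * (Real.sqrt 2 : ℂ) = 2 := by
      exact_mod_cast
        congrArg (fun x : ℝ => (x : ℂ)) (Real.mul_self_sqrt (by norm_num : (0 : ℝ) ≤ 2))
    rw [hc, ← mul_pow, div_mul_div_comm, hsq, one_mul, one_div, inv_pow]
  have h1 : (A.U *ᵥ fun y => A.probe y.1 * ket (b + s) (join s hs iI iT) y.2) =
      ∑ i' : Bits n, (c * sgn (iI ⬝ᵥ i')) •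
        (A.U *ᵥ fun y => A.probe y.1 * ket b (join s hs i' iT) y.2) := by
    simp only [← Matrix.mulVec_smul]
    rw [← Matrix.mulVec_sum]
    congr 1
    funext y
    rw [ket_inverted, Finset.mul_sum, Finset.sum_apply]
    refine Finset.sum_congr rfl fun i' _ => ?_
    rw [Pi.smul_apply, smul_eq_mul]
    ring
  unfold JointAttack.eveVec
  rw [h1, ← hcc]
  simp only [ket_inverted, star_sum, StarMul.star_mul, star_sgn, ← hc, hstar, Finset.sum_apply,
    Pi.smul_apply, smul_eq_mul]
  conv_rhs =>
    simp only [Finset.mul_sum]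
    enter [2, i']
    rw [Finset.sum_comm]
  rw [Finset.sum_comm (s := Finset.univ (α := Bits n))]
  refine Finset.sum_congr rfl fun x _ => ?_
  rw [Finset.sum_mul_sum, Finset.sum_comm]
  refine Finset.sum_congr rfl fun i' _ => Finset.sum_congr rfl fun j' _ => ?_
  ring

/-- Parseval on `F₂ⁿ`, used to sum over Alice's INFO string in the inverted protocol. -/
lemma sum_norm_sq_sgn_sum (a : Bits n → ℂ) :
    ∑ i : Bits n, ‖∑ d, sgn (i ⬝ᵥ d) * a d‖ ^ 2 = 2 ^ n * ∑ d, ‖a d‖ ^ 2 := by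
  refine Complex.ofReal_injective ?_
  push_cast
  simp only [← Complex.conj_mul', map_sum, map_mul, conj_sgn, Finset.sum_mul_sum]
  rw [Finset.sum_comm, Finset.mul_sum]
  refine Finset.sum_congr rfl fun d _ => ?_
  rw [Finset.sum_comm, Finset.sum_eq_single d]
  · have h : ∀ i : Bits n, sgn (i ⬝ᵥ d) * (starRingEnd ℂ) (a d) * (sgn (i ⬝ᵥ d) * a d) =
        (starRingEnd ℂ) (a d) * a d := fun i => by
      linear_combination (starRingEnd ℂ) (a d) * a d * sgn_mul_self (i ⬝ᵥ d)
    simp [h]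
  · intro d' _ hd
    have h : ∀ i : Bits n, sgn (i ⬝ᵥ d) * (starRingEnd ℂ) (a d) * (sgn (i ⬝ᵥ d') * a d') =
        (starRingEnd ℂ) (a d) * a d' * sgn (i ⬝ᵥ (d + d')) := fun i => by
      rw [dotProduct_add, sgn_add]; ring
    simp only [h]
    rw [← Finset.mul_sum, sum_sgn_dotProduct, if_neg, mul_zero]
    intro h0
    exact hd (by rw [← bits_add_add_cancel d' d, add_comm d', h0, zero_add])
  · simp

end InvertedBasis

/-! ### Purifications of Eve's states and the error distribution in the inverted basis. -/

section Purification

variable {N n : ℕ} {E : Type*} [Fintype E] [DecidableEq E]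

/-- The purification of Eve's state `ρ^{i_I}`: the system that purifies it holds the error string
`i_I ⊕ j_I`. -/
def JointAttack.purif (A : JointAttack N E) (b s : Bits N) (hs : hammingNorm s = n)
    (iT jT : Bits (N - n)) (iI : Bits n) : EuclideanSpace ℂ (Bits n × E) :=
  WithLp.toLp 2 fun p => A.eveCondVec b s hs iT jT iI (iI + p.1) p.2

lemma JointAttack.eveState_eq (A : JointAttack N E) (b s : Bits N) (hs : hammingNorm s = n)
    (iT jT : Bits (N - n)) (iI : Bits n) :
    A.eveState b s hs iT jT iI =
      ∑ d : Bits n, Matrix.vecMulVec (A.eveCondVec b s hs iT jT iI (iI + d))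
        (star (A.eveCondVec b s hs iT jT iI (iI + d))) :=
  (Equiv.sum_comp (Equiv.addLeft iI) fun jI =>
    Matrix.vecMulVec (A.eveCondVec b s hs iT jT iI jI)
      (star (A.eveCondVec b s hs iT jT iI jI))).symm

/-- Shift invariance makes the normalization of Eve's state the same for all INFO strings, so that
it factors out of Gram entries and Fourier sums. -/
lemma JointAttack.testOutcomeProb_symmetrize (A : JointAttack N E) (b s : Bits N)
    (hs : hammingNorm s = n) (iI : Bits n) (iT jT : Bits (N - n)) :
    A.symmetrize.testOutcomeProb b s hs iI iT jT =
      A.symmetrize.testOutcomeProb b s hs 0 iT jT := by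
  unfold JointAttack.testOutcomeProb
  rw [← Equiv.sum_comp (Equiv.addRight iI)]
  refine Finset.sum_congr rfl fun jI _ => ?_
  rw [← A.bornProb_symmetrize_shift b (join s hs 0 iT) (join s hs jI jT) (join s hs iI 0),
    ← join_add_zero, ← join_add_zero, zero_add]
  rfl

lemma JointAttack.testOutcomeProb_symmetrize_pos (A : JointAttack N E) {b s : Bits N}
    {hs : hammingNorm s = n} {iT jT : Bits (N - n)}
    (hpos : 0 < A.symmetrize.testProb b s hs iT jT) :
    0 < A.symmetrize.testOutcomeProb b s hs 0 iT jT := by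
  have h : A.symmetrize.testProb b s hs iT jT =
      2 ^ n * (1 / 2 ^ N * A.symmetrize.testOutcomeProb b s hs 0 iT jT) := by
    simp only [JointAttack.testProb, JointAttack.jointProb, ← Finset.mul_sum]
    have h1 : ∀ iI : Bits n, ∑ jI : Bits n,
        A.symmetrize.bornProb b (join s hs iI iT) (join s hs jI jT) =
        A.symmetrize.testOutcomeProb b s hs 0 iT jT := fun iI =>
      A.testOutcomeProb_symmetrize b s hs iI iT jT
    simp only [h1]
    rw [Finset.sum_const, Finset.card_univ, card_bits, nsmul_eq_mul]
    push_cast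
    ring
  rw [h] at hpos
  by_contra hle
  have : 1 / (2 : ℝ) ^ N * A.symmetrize.testOutcomeProb b s hs 0 iT jT ≤ 0 :=
    mul_nonpos_of_nonneg_of_nonpos (by positivity) (not_lt.1 hle)
  have h2 : (2 : ℝ) ^ n * (1 / 2 ^ N * A.symmetrize.testOutcomeProb b s hs 0 iT jT) ≤ 0 :=
    mul_nonpos_of_nonneg_of_nonpos (by positivity) this
  linarith

/-- Labelling the purifying system by the error string `d` pairs only vectors with equal error
strings, which is what `gram_symmetrize_shift` requires. -/
lemma JointAttack.inner_purif_shift (A : JointAttack N E) (b s : Bits N)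
    (hs : hammingNorm s = n) (iT jT : Bits (N - n)) (a i i' : Bits n) :
    (inner ℂ (A.symmetrize.purif b s hs iT jT (i + a))
        (A.symmetrize.purif b s hs iT jT (i' + a)) : ℂ) =
      inner ℂ (A.symmetrize.purif b s hs iT jT i) (A.symmetrize.purif b s hs iT jT i') := by
  have key : ∀ i i' : Bits n, (inner ℂ (A.symmetrize.purif b s hs iT jT i)
      (A.symmetrize.purif b s hs iT jT i') : ℂ) =
      ∑ d : Bits n, (1 / (Real.sqrt (A.symmetrize.testOutcomeProb b s hs 0 iT jT) : ℂ)) ^ 2 *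
        ∑ e, star (A.symmetrize.eveVec b (join s hs i iT) (join s hs (i + d) jT) e) *
          A.symmetrize.eveVec b (join s hs i' iT) (join s hs (i' + d) jT) e := by
    intro i i'
    rw [PiLp.inner_apply, Fintype.sum_prod_type]
    refine Finset.sum_congr rfl fun d _ => ?_
    rw [Finset.mul_sum]
    refine Finset.sum_congr rfl fun e _ => ?_
    simp only [JointAttack.purif, JointAttack.eveCondVec, Pi.smul_apply, smul_eq_mul,
      RCLike.inner_apply, map_mul, A.testOutcomeProb_symmetrize b s hs i,
      A.testOutcomeProb_symmetrize b s hs i', map_div₀, map_one, Complex.conj_ofReal,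
      Complex.star_def]
    ring
  rw [key, key]
  refine Finset.sum_congr rfl fun d _ => ?_
  congr 1
  have hx : ∀ i : Bits n, join s hs i iT + join s hs (i + d) jT = join s hs d (iT + jT) := by
    intro i
    rw [← join_add, ← add_assoc, bits_add_self, zero_add]
  rw [← A.gram_symmetrize_shift b (join s hs i iT) (join s hs (i + d) jT) (join s hs i' iT)
    (join s hs (i' + d) jT) (join s hs a 0) (by rw [hx, hx])]
  simp only [← join_add_zero, add_right_comm _ d a]

lemma JointAttack.norm_purif (A : JointAttack N E) {b s : Bits N}
    {hs : hammingNorm s = n} {iT jT : Bits (N - n)} {i : Bits n}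
    (hpos : 0 < A.testOutcomeProb b s hs i iT jT) :
    ‖A.purif b s hs iT jT i‖ = 1 := by
  have h : ∀ (d : Bits n) (e : E), ‖A.purif b s hs iT jT i (d, e)‖ ^ 2 =
      (A.testOutcomeProb b s hs i iT jT)⁻¹ *
        ‖A.eveVec b (join s hs i iT) (join s hs (i + d) jT) e‖ ^ 2 := by
    intro d e
    simp only [JointAttack.purif, JointAttack.eveCondVec, Pi.smul_apply, smul_eq_mul]
    rw [norm_mul, mul_pow, norm_div, norm_one, Complex.norm_real, Real.norm_eq_abs, div_pow,
      sq_abs, Real.sq_sqrt hpos.le, one_pow, one_div]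
  have hsum : A.testOutcomeProb b s hs i iT jT =
      ∑ d : Bits n, ∑ e, ‖A.eveVec b (join s hs i iT) (join s hs (i + d) jT) e‖ ^ 2 :=
    (Equiv.sum_comp (Equiv.addLeft i) fun j =>
      A.bornProb b (join s hs i iT) (join s hs j jT)).symm
  have hsq : ‖A.purif b s hs iT jT i‖ ^ 2 = 1 := by
    rw [EuclideanSpace.norm_sq_eq, Fintype.sum_prod_type]
    simp only [h, ← Finset.mul_sum]
    rw [← hsum]
    exact inv_mul_cancel₀ hpos.ne'
  exact (pow_eq_one_iff_of_nonneg (norm_nonneg _) two_ne_zero).1 hsq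

/-- Writing Bob's transform variable as `i' + d`, the sign of `i·i' + (i + c)·(i' + d)` is that of
`i·d + c·d + c·i'`. The sum over `i'` is then the Fourier coefficient at the error string `c`. -/
lemma JointAttack.eveVec_inverted_eq (A : JointAttack N E) {b s : Bits N}
    {hs : hammingNorm s = n} {iT jT : Bits (N - n)}
    (hpos : 0 < A.symmetrize.testOutcomeProb b s hs 0 iT jT) (i c : Bits n) (e : E × Bits N) :
    A.symmetrize.eveVec (b + s) (join s hs i iT) (join s hs (i + c) jT) e =
      ∑ d, sgn (i ⬝ᵥ d) *
        ((Real.sqrt (A.symmetrize.testOutcomeProb b s hs 0 iT jT) : ℂ) * sgn (c ⬝ᵥ d) *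
          fourierVec (A.symmetrize.purif b s hs iT jT) c (d, e)) := by
  set q := A.symmetrize.testOutcomeProb b s hs 0 iT jT with hq
  have hq0 : (Real.sqrt q : ℂ) ≠ 0 := by
    exact_mod_cast (Real.sqrt_pos.2 hpos).ne'
  have hf : ∀ d : Bits n, fourierVec (A.symmetrize.purif b s hs iT jT) c (d, e) =
      ((2 : ℂ) ^ n)⁻¹ * ∑ i', sgn (i' ⬝ᵥ c) * (1 / (Real.sqrt q : ℂ) *
        A.symmetrize.eveVec b (join s hs i' iT) (join s hs (i' + d) jT) e) := by
    intro d
    simp only [fourierVec, PiLp.smul_apply, WithLp.ofLp_sum, Finset.sum_apply, smul_eq_mul,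
      JointAttack.purif, JointAttack.eveCondVec, Pi.smul_apply, WithLp.ofLp_smul,
      A.testOutcomeProb_symmetrize b s hs _ iT jT, hq]
  have hd : ∀ d : Bits n, sgn (i ⬝ᵥ d) * ((Real.sqrt q : ℂ) * sgn (c ⬝ᵥ d) *
      fourierVec (A.symmetrize.purif b s hs iT jT) c (d, e)) =
      ((2 : ℂ) ^ n)⁻¹ * ∑ i', sgn (i ⬝ᵥ d) * sgn (c ⬝ᵥ d) * sgn (i' ⬝ᵥ c) *
        A.symmetrize.eveVec b (join s hs i' iT) (join s hs (i' + d) jT) e := by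
    intro d
    rw [hf]
    simp only [Finset.mul_sum]
    refine Finset.sum_congr rfl fun i' _ => ?_
    field_simp
  simp only [hd]
  rw [JointAttack.eveVec_inverted, ← Finset.mul_sum]
  congr 1
  rw [Finset.sum_comm (s := Finset.univ (α := Bits n)) (f := fun d i' => sgn (i ⬝ᵥ d) * _ * _ * _)]
  refine Finset.sum_congr rfl fun i' _ => ?_
  rw [← Equiv.sum_comp (Equiv.addLeft i')]
  refine Finset.sum_congr rfl fun d _ => ?_
  rw [Equiv.coe_addLeft]
  congr 1
  simp only [dotProduct_add, add_dotProduct, sgn_add, dotProduct_comm i' c]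
  linear_combination sgn (i ⬝ᵥ d) * sgn (c ⬝ᵥ d) * sgn (c ⬝ᵥ i') * sgn_mul_self (i ⬝ᵥ i')

/-- In the inverted-INFO-basis protocol, the distribution of the error string is given by the
squared norms of the Fourier coefficients of the purifications. -/
lemma JointAttack.sum_jointProb_inverted (A : JointAttack N E) {b s : Bits N}
    {hs : hammingNorm s = n} {iT jT : Bits (N - n)}
    (hpos : 0 < A.symmetrize.testOutcomeProb b s hs 0 iT jT) (c : Bits n) :
    ∑ i : Bits n, A.symmetrize.jointProb (b + s) (join s hs i iT) (join s hs (i + c) jT) =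
      1 / 2 ^ N * (2 ^ n * A.symmetrize.testOutcomeProb b s hs 0 iT jT) *
        ‖fourierVec (A.symmetrize.purif b s hs iT jT) c‖ ^ 2 := by
  simp only [JointAttack.jointProb, JointAttack.bornProb]
  rw [← Finset.mul_sum, mul_assoc, Finset.sum_comm]
  simp only [A.eveVec_inverted_eq hpos, sum_norm_sq_sgn_sum, norm_mul, norm_sgn, mul_one, mul_pow,
    Complex.norm_real, Real.norm_eq_abs, sq_abs, Real.sq_sqrt hpos.le]
  have hn : ‖fourierVec (A.symmetrize.purif b s hs iT jT) c‖ ^ 2 =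
      ∑ e, ∑ d, ‖fourierVec (A.symmetrize.purif b s hs iT jT) c (d, e)‖ ^ 2 := by
    rw [EuclideanSpace.norm_sq_eq, Fintype.sum_prod_type, Finset.sum_comm]
  simp only [← Finset.mul_sum]
  rw [hn]
  ring

open Classical in
lemma JointAttack.sum_infoError_inverted (A : JointAttack N E) {b s : Bits N}
    {hs : hammingNorm s = n} {iT jT : Bits (N - n)}
    (hpos : 0 < A.symmetrize.testOutcomeProb b s hs 0 iT jT) (X : Set (Bits n)) :
    (∑ iI : Bits n, ∑ jI : Bits n, if iI + jI ∈ X then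
        A.symmetrize.jointProb (b + s) (join s hs iI iT) (join s hs jI jT) else 0) =
      1 / 2 ^ N * (2 ^ n * A.symmetrize.testOutcomeProb b s hs 0 iT jT) *
        ∑ c : Bits n with c ∈ X, ‖fourierVec (A.symmetrize.purif b s hs iT jT) c‖ ^ 2 := by
  have h : ∀ i : Bits n, (∑ j : Bits n, if i + j ∈ X then
        A.symmetrize.jointProb (b + s) (join s hs i iT) (join s hs j jT) else 0) =
      ∑ c : Bits n, if c ∈ X then
        A.symmetrize.jointProb (b + s) (join s hs i iT) (join s hs (i + c) jT) else 0 := by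
    intro i
    rw [← Equiv.sum_comp (Equiv.addLeft i)]
    simp only [Equiv.coe_addLeft, ← add_assoc, bits_add_self, zero_add]
  simp only [h]
  rw [Finset.sum_comm, Finset.mul_sum, Finset.sum_filter]
  refine Finset.sum_congr rfl fun c _ => ?_
  split_ifs
  · exact A.sum_jointProb_inverted hpos c
  · simp

-- Numerator and denominator share one positive prefactor, and for all error strings together the
-- squared norms add up to `‖φ_0‖² = 1`.
open Classical in
lemma JointAttack.invertedInfoErrorProb_symmetrize (A : JointAttack N E) {b s : Bits N}
    {hs : hammingNorm s = n} {iT jT : Bits (N - n)}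
    (hpos : 0 < A.symmetrize.testOutcomeProb b s hs 0 iT jT) (X : Set (Bits n)) :
    A.symmetrize.invertedInfoErrorProb b s hs iT jT X =
      ∑ c : Bits n with c ∈ X, ‖fourierVec (A.symmetrize.purif b s hs iT jT) c‖ ^ 2 := by
  have h1 := A.sum_infoError_inverted hpos Set.univ
  have h2 := norm_sq_sum_fourierVec (A.inner_purif_shift b s hs iT jT) Finset.univ 0
  rw [sum_fourierVec, A.symmetrize.norm_purif hpos] at h2
  simp only [Set.mem_univ, if_true, Finset.filter_true, ← h2, one_pow, mul_one] at h1
  rw [JointAttack.invertedInfoErrorProb, JointAttack.infoErrorProb, JointAttack.testProb, h1,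
    A.sum_infoError_inverted hpos X]
  exact mul_div_cancel_left₀ _ (by positivity)

end Purification

/-! ### Distinguishing the two key states, and averaging over the random code and key vector. -/

section KeyStates

variable {N n r m : ℕ} {E : Type*} [Fintype E] [DecidableEq E]

lemma JointAttack.isHermitian_eveState (A : JointAttack N E) (b s : Bits N)
    (hs : hammingNorm s = n) (iT jT : Bits (N - n)) (iI : Bits n) :
    (A.eveState b s hs iT jT iI).IsHermitian := by
  rw [Matrix.IsHermitian, JointAttack.eveState, Matrix.conjTranspose_sum]
  refine Finset.sum_congr rfl fun jI _ => ?_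
  rw [Matrix.conjTranspose_vecMulVec, star_star]

lemma JointAttack.isHermitian_keyState (A : JointAttack N E) (b s : Bits N)
    (hs : hammingNorm s = n) (iT jT : Bits (N - n)) (ξ : Bits r) (k : Bits m) :
    (A.keyState b s hs iT jT ξ k).IsHermitian := by
  rw [Matrix.IsHermitian, JointAttack.keyState, Matrix.conjTranspose_smul,
    Matrix.conjTranspose_sum]
  congr 1
  · simp
  refine Finset.sum_congr rfl fun P _ => ?_
  rw [Matrix.conjTranspose_sum]
  refine Finset.sum_congr rfl fun i _ => ?_
  split_ifs
  · rw [Matrix.conjTranspose_smul, Matrix.conjTranspose_kronecker,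
      (A.isHermitian_eveState b s hs iT jT i).eq, Matrix.conjTranspose_single]
    simp
  · simp

lemma vecMul_transpose_eq_iff (P : MatPair n r 1) (i : Bits n) (k : ZMod 2) :
    i ᵥ* P.2ᵀ = ![k] ↔ i ⬝ᵥ P.keyVec = k := by
  have h : (i ᵥ* P.2ᵀ) 0 = i ⬝ᵥ P.keyVec := rfl
  constructor
  · intro hk
    rw [← h, hk]
    rfl
  · intro hk
    funext a
    rw [Subsingleton.elim a 0, h, hk]
    rfl

open Classical in
lemma JointAttack.keyState_sub_keyState (A : JointAttack N E) (b s : Bits N)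
    (hs : hammingNorm s = n) (iT jT : Bits (N - n)) (ξ : Bits r) :
    A.keyState b s hs iT jT ξ (![0] : Bits 1) - A.keyState b s hs iT jT ξ (![1] : Bits 1) =
      (1 / 2 ^ (n - r - 1) : ℂ) • ∑ P : MatPair n r 1, (P.prob : ℂ) •
        ∑ i : Bits n with i ᵥ* P.1ᵀ = ξ, sgn (i ⬝ᵥ P.keyVec) •
          (A.eveState b s hs iT jT i ⊗ₖ Matrix.single P P 1) := by
  rw [JointAttack.keyState, JointAttack.keyState, ← smul_sub, ← Finset.sum_sub_distrib]
  congr 1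
  refine Finset.sum_congr rfl fun P _ => ?_
  rw [← Finset.sum_sub_distrib, Finset.smul_sum, Finset.sum_filter]
  refine Finset.sum_congr rfl fun i _ => ?_
  simp only [vecMul_transpose_eq_iff]
  by_cases h1 : i ᵥ* P.1ᵀ = ξ
  · have hval : ∀ x : ZMod 2, x = 0 ∨ x = 1 := by decide
    rcases hval (i ⬝ᵥ P.keyVec) with h2 | h2 <;> simp [h1, h2]
  · simp [h1]

/-- The words of weight less than `t` that stay distinguishable from all other such words when the
key vector is added to the code. -/
def goodWords (t : ℕ) (P : MatPair n r 1) : Finset (Bits n) :=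
  open Classical in
  Finset.univ.filter fun l => hammingNorm l < t ∧
    ¬ ∃ l' ∈ Finset.univ.filter (fun l' : Bits n => hammingNorm l' < t),
      l + l' + P.keyVec ∈ rowSpan P.1

lemma sum_coset_sgn_goodWords {t : ℕ} {P : MatPair n r 1} {l l' : Bits n}
    (hl : l ∈ goodWords t P) (hl' : l' ∈ goodWords t P) (ξ : Bits r) :
    ∑ i : Bits n with i ᵥ* P.1ᵀ = ξ, sgn (i ⬝ᵥ (l + l' + P.keyVec)) = 0 := by
  simp only [goodWords, Finset.mem_filter, Finset.mem_univ, true_and] at hl hl'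
  exact sum_coset_sgn_eq_zero (fun h => hl.2 ⟨l', hl'.1, h⟩) ξ

/-- A unitary attaining the trace norm acts through one contractive block for each register value,
and `norm_sum_sgn_inner_le` applies to each block separately. -/
lemma JointAttack.traceNorm_keyState_sub_le (A : JointAttack N E) (b s : Bits N)
    (hs : hammingNorm s = n) (hrn : r + 1 ≤ n) (iT jT : Bits (N - n))
    (hpos : 0 < A.symmetrize.testProb b s hs iT jT) (ξ : Bits r) (t : ℕ) :
    traceNorm (A.symmetrize.keyState b s hs iT jT ξ (![0] : Bits 1) -
        A.symmetrize.keyState b s hs iT jT ξ (![1] : Bits 1)) ≤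
      ∑ P : MatPair n r 1, P.prob * (4 * Real.sqrt (∑ l ∈ (goodWords t P)ᶜ,
        ‖fourierVec (A.symmetrize.purif b s hs iT jT) l‖ ^ 2)) := by
  classical
  obtain ⟨W, hW, hWX⟩ := exists_unitary_traceNorm_eq
    ((A.symmetrize.isHermitian_keyState b s hs iT jT ξ (![0] : Bits 1)).sub
      (A.symmetrize.isHermitian_keyState b s hs iT jT ξ (![1] : Bits 1)))
  have hq := A.testOutcomeProb_symmetrize_pos hpos
  set φ := A.symmetrize.purif b s hs iT jT with hφ
  have htr : ∀ (P : MatPair n r 1) (i : Bits n),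
      (W * (A.symmetrize.eveState b s hs iT jT i ⊗ₖ Matrix.single P P 1)).trace =
        inner ℂ (φ i) (blockMap (Bits n) W P (φ i)) := by
    intro P i
    rw [JointAttack.eveState_eq]
    exact trace_mul_kronecker_single W P fun d =>
      A.symmetrize.eveCondVec b s hs iT jT i (i + d)
  rw [hWX, A.symmetrize.keyState_sub_keyState]
  refine (Complex.re_le_norm _).trans ?_
  simp only [Matrix.mul_smul, Matrix.mul_sum, Matrix.trace_smul, Matrix.trace_sum, htr,
    smul_eq_mul]
  rw [Finset.mul_sum]
  refine norm_sum_le_of_le _ fun P _ => ?_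
  -- Pairs of probability zero contribute nothing; for the others independence of the rows bounds
  -- the coset.
  by_cases hP : P.prob = 0
  · simp [hP]
  have hcard := card_coset_le ((MatPair.valid_iff P).1 (MatPair.valid_of_prob_ne_zero hP)).1 ξ
  have hcore := norm_sum_sgn_inner_le (A.inner_purif_shift b s hs iT jT)
    (fun i => A.symmetrize.norm_purif ((A.testOutcomeProb_symmetrize b s hs i iT jT).symm ▸ hq))
    (blockMap (Bits n) W P) (norm_blockMap_le hW P)
    (Finset.univ.filter fun i : Bits n => i ᵥ* P.1ᵀ = ξ) (goodWords t P) P.keyVec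
    (fun l hl l' hl' => sum_coset_sgn_goodWords hl hl' ξ)
  rw [norm_mul, norm_mul, Complex.norm_real, Real.norm_eq_abs, abs_of_nonneg P.prob_nonneg,
    mul_left_comm]
  refine mul_le_mul_of_nonneg_left ?_ P.prob_nonneg
  set R := Real.sqrt (∑ l ∈ (goodWords t P)ᶜ, ‖fourierVec φ l‖ ^ 2) with hR
  have hR0 : 0 ≤ R := Real.sqrt_nonneg _
  -- A coset has up to `2^(n-r)` words but the key state is normalized by `2^(n-r-1)`; this doubles
  -- the constant `2` of the core estimate to `4`.
  have hc : ‖(1 / 2 ^ (n - r - 1) : ℂ)‖ * 2 ^ (n - r) = 2 := by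
    have : n - r = (n - r - 1) + 1 := by omega
    rw [norm_div, norm_one, norm_pow, Complex.norm_ofNat, this, pow_succ, Nat.add_sub_cancel]
    field_simp
  calc _ ≤ ‖(1 / 2 ^ (n - r - 1) : ℂ)‖ * (2 ^ (n - r) * (2 * R)) := by
        refine mul_le_mul_of_nonneg_left (hcore.trans ?_) (norm_nonneg _)
        exact mul_le_mul_of_nonneg_right (by exact_mod_cast hcard) (by positivity)
    _ = 4 * R := by rw [← mul_assoc, hc]; ring

/-- Jensen for the square root, as Cauchy-Schwarz applied to `√p` and `√(p f)`. -/
lemma sum_prob_mul_sqrt_le {f : MatPair n r 1 → ℝ} (hf : ∀ P, 0 ≤ f P) :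
    ∑ P : MatPair n r 1, P.prob * Real.sqrt (f P) ≤
      Real.sqrt (∑ P : MatPair n r 1, P.prob * f P) := by
  have h := Real.sum_sqrt_mul_sqrt_le (f := fun P : MatPair n r 1 => P.prob)
    (g := fun P => P.prob * f P) Finset.univ MatPair.prob_nonneg
    (fun P => mul_nonneg P.prob_nonneg (hf P))
  have h1 : ∀ P : MatPair n r 1, Real.sqrt P.prob * Real.sqrt (P.prob * f P) =
      P.prob * Real.sqrt (f P) := fun P => by
    rw [Real.sqrt_mul P.prob_nonneg, ← mul_assoc, Real.mul_self_sqrt P.prob_nonneg]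
  simp only [h1] at h
  refine h.trans (mul_le_of_le_one_left (Real.sqrt_nonneg _) ?_)
  exact Real.sqrt_le_one.2 sum_prob_le_one

/-- The expected weight outside the good words. -/
lemma sum_prob_mul_compl_goodWords_le (hrn : r + 1 ≤ n) {t : ℕ} (ht : (t : ℝ) ≤ n / 2)
    {w : Bits n → ℝ} (hw : ∀ l, 0 ≤ w l) (hw1 : ∑ l, w l = 1) :
    ∑ P : MatPair n r 1, P.prob * ∑ l ∈ (goodWords t P)ᶜ, w l ≤
      (∑ l : Bits n with t ≤ hammingNorm l, w l) +
        (2 : ℝ) ^ ((n : ℝ) * (H₂ ((t : ℝ) / n) - ((n : ℝ) - r - 1) / n)) := by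
  classical
  set L : Finset (Bits n) := Finset.univ.filter fun l => hammingNorm l < t with hL
  have hn : (0 : ℝ) < n := by
    have : 0 < n := by omega
    exact_mod_cast this
  have hexp : (L.card : ℝ) * 2 ^ (r + 1) / 2 ^ n ≤
      (2 : ℝ) ^ ((n : ℝ) * (H₂ ((t : ℝ) / n) - ((n : ℝ) - r - 1) / n)) := by
    have h1 : (n : ℝ) * (H₂ ((t : ℝ) / n) - ((n : ℝ) - r - 1) / n) =
        n * H₂ ((t : ℝ) / n) + ((r + 1 : ℕ) : ℝ) - (n : ℕ) := by
      push_cast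
      field_simp
      ring
    rw [h1, Real.rpow_sub two_pos, Real.rpow_add two_pos, Real.rpow_natCast, Real.rpow_natCast]
    have := card_hammingNorm_lt_le ht
    gcongr
  -- A word that is not good is heavy or confused; a word that is both is counted twice, which is
  -- harmless.
  have hsplit : ∀ P : MatPair n r 1, ∑ l ∈ (goodWords t P)ᶜ, w l ≤
      (∑ l : Bits n with t ≤ hammingNorm l, w l) +
        ∑ l : Bits n, if ∃ l' ∈ L, l + l' + P.keyVec ∈ rowSpan P.1 then w l else 0 := by
    intro P
    have hG : (goodWords t P)ᶜ = Finset.univ.filter fun l => l ∉ goodWords t P := by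
      ext l
      simp
    rw [hG, Finset.sum_filter, Finset.sum_filter, ← Finset.sum_add_distrib]
    refine Finset.sum_le_sum fun l _ => ?_
    have hl : l ∈ goodWords t P ↔
        hammingNorm l < t ∧ ¬ ∃ l' ∈ L, l + l' + P.keyVec ∈ rowSpan P.1 := by
      simp [goodWords, hL]
    have := hw l
    by_cases h1 : t ≤ hammingNorm l
    · rw [if_pos h1]
      split_ifs <;> linarith
    by_cases h2 : ∃ l' ∈ L, l + l' + P.keyVec ∈ rowSpan P.1
    · rw [if_pos h2, if_neg h1]
      split_ifs <;> linarith
    · rw [if_neg (not_not.2 (hl.2 ⟨not_le.1 h1, h2⟩)), if_neg h1, if_neg h2, add_zero]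
  -- The bound on the confusion probability is uniform in `l`, so it survives averaging against the
  -- weights `w`, which do not depend on `P`.
  have hconf : ∀ l : Bits n, ∑ P : MatPair n r 1,
      P.prob * (if ∃ l' ∈ L, l + l' + P.keyVec ∈ rowSpan P.1 then w l else 0) ≤
        w l * ((L.card : ℝ) * 2 ^ (r + 1) / 2 ^ n) := by
    intro l
    refine le_trans (le_of_eq ?_) (mul_le_mul_of_nonneg_left (sum_prob_confused_le hrn L l) (hw l))
    rw [Finset.mul_sum]
    refine Finset.sum_congr rfl fun P _ => ?_
    split_ifs
    · exact mul_comm _ _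
    · simp
  calc _ ≤ ∑ P : MatPair n r 1, P.prob * ((∑ l : Bits n with t ≤ hammingNorm l, w l) +
        ∑ l : Bits n, if ∃ l' ∈ L, l + l' + P.keyVec ∈ rowSpan P.1 then w l else 0) :=
        Finset.sum_le_sum fun P _ => mul_le_mul_of_nonneg_left (hsplit P) P.prob_nonneg
    _ = (∑ P : MatPair n r 1, P.prob) * (∑ l : Bits n with t ≤ hammingNorm l, w l) +
        ∑ l : Bits n, ∑ P : MatPair n r 1,
          P.prob * (if ∃ l' ∈ L, l + l' + P.keyVec ∈ rowSpan P.1 then w l else 0) := by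
        rw [Finset.sum_comm]
        simp only [mul_add, Finset.sum_add_distrib, Finset.mul_sum, Finset.sum_mul]
        congr 1
        exact Finset.sum_comm
    _ ≤ 1 * (∑ l : Bits n with t ≤ hammingNorm l, w l) +
        ∑ l : Bits n, w l * ((L.card : ℝ) * 2 ^ (r + 1) / 2 ^ n) := by
        refine add_le_add (mul_le_mul_of_nonneg_right sum_prob_le_one
          (Finset.sum_nonneg fun l _ => hw l)) (Finset.sum_le_sum fun l _ => hconf l)
    _ ≤ _ := by
        rw [one_mul, ← Finset.sum_mul, hw1, one_mul]
        exact add_le_add_right hexp _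

end KeyStates

end BB84

end

theorem mainTheorem3 {N n r : ℕ} (hrn : r + 1 ≤ n)
    {E : Type*} [Fintype E] [DecidableEq E] (A : BB84.JointAttack N E)
    (b s : BB84.Bits N) (hs : hammingNorm s = n) (iT jT : BB84.Bits (N - n))
    (hpos : 0 < A.symmetrize.testProb b s hs iT jT)
    (ξ : BB84.Bits r) (t : ℕ) (ht : (t : ℝ) ≤ n / 2) :
    1 / 2 * BB84.traceNorm
        (A.symmetrize.keyState b s hs iT jT ξ (![0] : BB84.Bits 1) -
          A.symmetrize.keyState b s hs iT jT ξ (![1] : BB84.Bits 1)) ≤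
      2 * Real.sqrt
        (A.symmetrize.invertedInfoErrorProb b s hs iT jT {c | t ≤ hammingNorm c} +
          (2 : ℝ) ^ ((n : ℝ) *
            (BB84.H₂ ((t : ℝ) / n) - ((n : ℝ) - r - 1) / n))) := by
  have hq := A.testOutcomeProb_symmetrize_pos hpos
  set w : BB84.Bits n → ℝ := fun l =>
    ‖BB84.fourierVec (A.symmetrize.purif b s hs iT jT) l‖ ^ 2 with hw
  have hw1 : ∑ l, w l = 1 := by
    have h := BB84.norm_sq_sum_fourierVec (A.inner_purif_shift b s hs iT jT) Finset.univ 0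
    rw [BB84.sum_fourierVec, A.symmetrize.norm_purif hq, one_pow] at h
    exact h.symm
  have hw0 : ∀ l, 0 ≤ w l := fun l => by positivity
  have hinv : A.symmetrize.invertedInfoErrorProb b s hs iT jT {c | t ≤ hammingNorm c} =
      ∑ l : BB84.Bits n with t ≤ hammingNorm l, w l := by
    rw [A.invertedInfoErrorProb_symmetrize hq]
    simp only [Set.mem_ofPred_eq]
    congr
  rw [hinv]
  have h1 := A.traceNorm_keyState_sub_le b s hs hrn iT jT hpos ξ t
  have h2 := BB84.sum_prob_mul_sqrt_le (n := n) (r := r)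
    (f := fun P => ∑ l ∈ (BB84.goodWords t P)ᶜ, w l)
    fun P => Finset.sum_nonneg fun l _ => hw0 l
  have h3 := Real.sqrt_le_sqrt
    (BB84.sum_prob_mul_compl_goodWords_le hrn ht hw0 hw1)
  -- The factor `1/2` of the trace distance turns the constant `4` into the stated `2`.
  simp only [mul_left_comm _ (4 : ℝ), ← Finset.mul_sum] at h1
  linarith
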